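/- Rays, cones and fans in $\mathbb{R}^n$ are rational with respect to the lattice $\mathbb{Z}^n$. A fan is a finite nonempty set of strictly convex rational polyhedral cones that is closed under taking faces and in which any two cones intersect in a common face; its rays are its one-dimensional cones. A fan is complete if the union of its cones is $\mathbb{R}^n$, projective if it is the normal fan of a rational polytope, and simplicial if every cone $\sigma$ in it is generated by exactly $\dim\sigma$ rays. Given a set $R$ of rays, a fan is called maximal with respect to $R$ if it is maximal, with respect to inclusion of sets of cones, among all fans whose rays belong to $R$ (not every ray in $R$ need occur in it). Theorem. For every $n \ge 4$ there exists a finite set $R$ of rays in $\mathbb{R}^n$, with $\operatorname{Cone}(R) = \mathbb{R}^n$, such that every fan in $\mathbb{R}^n$ that is maximal with respect to $R$ is either projective or non-complete, with both possibilities occurring. In both the projective and the non-projective (hence non-complete) cases, both simplicial and non-simplicial fans occur. That is, among the fans maximal with respect to $R$ there are a projective simplicial one, a projective non-simplicial one, a non-complete (and non-projective) simplicial one, and a non-complete (and non-projective) non-simplicial one. -/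

import Mathlib

open scoped Matrix

/-- The lattice vector `v ∈ ℤⁿ`, seen in `ℝⁿ`. -/
def latticeVec {n : ℕ} (v : Fin n → ℤ) : Fin n → ℝ := fun i => (v i : ℝ)

/-- A rational ray: the half-line from the origin through a nonzero lattice vector. -/
def IsRationalRay {n : ℕ} (ρ : PointedCone ℝ (Fin n → ℝ)) : Prop :=
  ∃ v : Fin n → ℤ, v ≠ 0 ∧ ρ = PointedCone.hull ℝ {latticeVec v}

/-- A rational polyhedral cone: one generated by finitely many lattice vectors. -/
def IsRationalPolyhedral {n : ℕ} (σ : PointedCone ℝ (Fin n → ℝ)) : Prop :=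
  ∃ S : Finset (Fin n → ℤ), σ = PointedCone.hull ℝ (latticeVec '' (S : Set (Fin n → ℤ)))

/-- The dimension of a cone: the dimension of its linear span. -/
noncomputable def coneDim {n : ℕ} (σ : PointedCone ℝ (Fin n → ℝ)) : ℕ :=
  Module.finrank ℝ (Submodule.span ℝ (σ : Set (Fin n → ℝ)))

/-- A (rational polyhedral) fan in `ℝⁿ` with respect to the lattice `ℤⁿ`: a finite nonempty set of
strictly convex rational polyhedral cones, closed under taking faces, any two of which intersect in
a common face. -/
structure IsFan {n : ℕ} (Δ : Set (PointedCone ℝ (Fin n → ℝ))) : Prop where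
  finite : Δ.Finite
  nonempty : Δ.Nonempty
  rational : ∀ σ ∈ Δ, IsRationalPolyhedral σ
  salient : ∀ σ ∈ Δ, (σ : ConvexCone ℝ (Fin n → ℝ)).Salient
  face_mem : ∀ σ ∈ Δ, ∀ τ : PointedCone ℝ (Fin n → ℝ), τ.IsFaceOf σ → τ ∈ Δ
  inter_left : ∀ σ ∈ Δ, ∀ τ ∈ Δ, (σ ⊓ τ).IsFaceOf σ
  inter_right : ∀ σ ∈ Δ, ∀ τ ∈ Δ, (σ ⊓ τ).IsFaceOf τ

/-- The set `Δ(1)` of rays of a fan: its one-dimensional cones. -/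
def fanRays {n : ℕ} (Δ : Set (PointedCone ℝ (Fin n → ℝ))) : Set (PointedCone ℝ (Fin n → ℝ)) :=
  {ρ | ρ ∈ Δ ∧ coneDim ρ = 1}

/-- `Δ` is maximal with respect to `R`: it is maximal for inclusion among all fans whose rays
belong to `R`. -/
def IsMaximalFan {n : ℕ} (R Δ : Set (PointedCone ℝ (Fin n → ℝ))) : Prop :=
  Maximal (fun Δ' : Set (PointedCone ℝ (Fin n → ℝ)) => IsFan Δ' ∧ fanRays Δ' ⊆ R) Δ

/-- The union of the cones is all of `ℝⁿ`. -/
def IsCompleteFan {n : ℕ} (Δ : Set (PointedCone ℝ (Fin n → ℝ))) : Prop :=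
  ∀ x : Fin n → ℝ, ∃ σ ∈ Δ, x ∈ σ

/-- Every cone is generated by linearly independent vectors, that is, by exactly as many rays as
its dimension. -/
def IsSimplicialFan {n : ℕ} (Δ : Set (PointedCone ℝ (Fin n → ℝ))) : Prop :=
  ∀ σ ∈ Δ, σ.IsSimplicial

/-- A rational polytope: the convex hull of a finite nonempty set of rational points. -/
def IsRationalPolytope {n : ℕ} (P : Set (Fin n → ℝ)) : Prop :=
  ∃ S : Finset (Fin n → ℚ), S.Nonempty ∧
    P = convexHull ℝ ((fun (q : Fin n → ℚ) (i : Fin n) => (q i : ℝ)) '' (S : Set (Fin n → ℚ)))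

/-- The (inner) normal cone of `F ⊆ P`: all `u` such that the pairing with `u` attains its minimum
over `P` at every point of `F`. -/
def normalCone {n : ℕ} (P F : Set (Fin n → ℝ)) : PointedCone ℝ (Fin n → ℝ) where
  carrier := {u | ∀ m ∈ F, ∀ m' ∈ P, m ⬝ᵥ u ≤ m' ⬝ᵥ u}
  zero_mem' := by
    intro m _ m' _
    simp
  add_mem' := by
    intro u w hu hw m hm m' hm'
    simp only [dotProduct_add]
    exact add_le_add (hu m hm m' hm') (hw m hm m' hm')
  smul_mem' := by
    intro c u hu m hm m' hm'
    have h := mul_le_mul_of_nonneg_left (hu m hm m' hm') c.2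
    simpa only [← Nonneg.coe_smul, dotProduct_smul, smul_eq_mul] using h

/-- The normal fan of `P`: the normal cones of all nonempty (exposed) faces of `P`, including `P`
itself. -/
def normalFan {n : ℕ} (P : Set (Fin n → ℝ)) : Set (PointedCone ℝ (Fin n → ℝ)) :=
  {σ | ∃ F : Set (Fin n → ℝ), F.Nonempty ∧ IsExposed ℝ P F ∧ σ = normalCone P F}

/-- `Δ` is the normal fan of a rational polytope. (When the cones of `Δ` are strictly convex,
such a polytope is necessarily full-dimensional.) -/
def IsProjectiveFan {n : ℕ} (Δ : Set (PointedCone ℝ (Fin n → ℝ))) : Prop :=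
  ∃ P : Set (Fin n → ℝ), IsRationalPolytope P ∧ Δ = normalFan P

/-! ### Generators and faces of cones. -/

section Cones

variable {E : Type*} [AddCommGroup E] [Module ℝ E]

open PointedCone

/-! The proof exhibits seven rays in ℝ⁴ and passes from dimension n to n + 1 by suspension: a fan is
multiplied by the fan {ℝ≥0, 0, ℝ≤0} of the projective line, and the two rays of the new axis join
the ray set. A strictly convex cone over the enlarged ray set contains at most one direction of the
axis and is therefore a product, so every fan over the new rays lies in the suspension of its
equator (`subset_suspension_equator`). Maximality, completeness, incompleteness and
(non-)simpliciality thus survive suspension. Projectivity is carried along as a strictly convex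
rational support function, `HasStrictSupport`, which behaves well under products and subfans and
yields a polytope as soon as the fan is complete (`HasStrictSupport.isProjectiveFan`).

In ℝ⁴ a cone is recorded by the bit mask of the generators that are absent from it. Absence is the
convenient side: a vertex of {m | ⟨m, vᵢ⟩ ≥ -cᵢ} has as mask the set of inequalities that are strict
there, and averaging vertices takes unions of masks. Two cones of one fan obey a sign condition for
each linear dependence of the generators (`IsFan.compatible`), and a complete fan has a cone
containing each of nine test vectors. A finite search over these necessary conditions shows that the
masks of any complete fan are unions of vertex masks of one of 24 explicit polytopes
(`IsCompleteFan.exists_certificate`). Hence every complete fan over the seven rays, maximal or not,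
has a strict support function (`IsFan.hasStrictSupport`).

The four required fans are given by lists of maximal cones. Sums of integral functionals separate
the cones and prove the fan axioms (`isFan_listFan`); linear dependences exclude any further cone
(`isMaximalFan_listFan`). Incompleteness of two of them needs no uncovered point: their masks fit
none of the 24 polytopes (`not_isCompleteFan_listFan`). -/

theorem mem_hull_image_iff {ι : Type*} [Fintype ι] (v : ι → E) (I : Set ι) (x : E) :
    x ∈ hull ℝ (v '' I) ↔
      ∃ c : ι → ℝ, (∀ i, 0 ≤ c i) ∧ (∀ i, i ∉ I → c i = 0) ∧ ∑ i, c i • v i = x := by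
  classical
  constructor
  · intro hx
    induction hx using Submodule.span_induction with
    | mem x hx =>
      obtain ⟨i, hi, rfl⟩ := hx
      refine ⟨Pi.single i 1, fun j => ?_, fun j hj => ?_, ?_⟩
      · by_cases h : j = i
        · subst h; simp
        · simp [h]
      · have : j ≠ i := fun h => hj (h ▸ hi)
        simp [this]
      · simp [Pi.single_apply]
    | zero => exact ⟨0, by simp, by simp, by simp⟩
    | add x y _ _ hx hy =>
      obtain ⟨c, hc, hc', rfl⟩ := hx
      obtain ⟨d, hd, hd', rfl⟩ := hy
      exact ⟨c + d, fun i => add_nonneg (hc i) (hd i), fun i hi => by simp [hc' i hi, hd' i hi],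
        by simp [add_smul, Finset.sum_add_distrib]⟩
    | smul a x _ hx =>
      obtain ⟨c, hc, hc', rfl⟩ := hx
      refine ⟨fun i => a.1 * c i, fun i => mul_nonneg a.2 (hc i), fun i hi => by simp [hc' i hi],
        ?_⟩
      rw [Finset.smul_sum]
      exact Finset.sum_congr rfl fun i _ => mul_smul _ _ _
  · rintro ⟨c, hc, hc', rfl⟩
    refine Submodule.sum_mem _ fun i _ => ?_
    by_cases hi : i ∈ I
    · exact PointedCone.smul_mem _ (hc i) (subset_hull ⟨i, hi, rfl⟩)
    · simp [hc' i hi]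

theorem mem_hull_singleton_iff (v x : E) : x ∈ hull ℝ {v} ↔ ∃ t : ℝ, 0 ≤ t ∧ t • v = x := by
  rw [Submodule.mem_span_singleton]
  exact ⟨fun ⟨a, h⟩ => ⟨a.1, a.2, h⟩, fun ⟨t, ht, h⟩ => ⟨⟨t, ht⟩, h⟩⟩

/-- In a nonnegative combination of S that lies in F, the face property puts every term with
positive coefficient in F. Faces thus correspond to subsets of a generating set, which makes them
rational and finite in number. -/
theorem PointedCone.IsFaceOf.eq_hull_inter {S : Set E} {F : PointedCone ℝ E}
    (hF : F.IsFaceOf (hull ℝ S)) : F = hull ℝ (S ∩ F) := by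
  refine le_antisymm (fun x hx => ?_) (Submodule.span_le.2 Set.inter_subset_right)
  have key : ∀ x ∈ hull ℝ S, x ∈ F → x ∈ hull ℝ (S ∩ F) := by
    intro x hx
    induction hx using Submodule.span_induction with
    | mem x hx => exact fun h => subset_hull ⟨hx, h⟩
    | zero => exact fun _ => zero_mem _
    | add x y hx hy ihx ihy =>
      intro h
      exact add_mem (ihx (hF.mem_of_add_mem_left hx hy h)) (ihy (hF.mem_of_add_mem_right hx hy h))
    | smul a x hx ih =>
      intro h
      rcases a.2.eq_or_lt with h0 | h0
      · have : a = 0 := Subtype.ext h0.symm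
        rw [this, zero_smul]
        exact zero_mem _
      · exact Submodule.smul_mem _ a (ih ((PointedCone.smul_mem_iff F h0).1 h))
  exact key x (hF.le hx) hx

/-- A face cut out of a cone by a linear functional that is nonnegative on it. -/
theorem isFaceOf_of_functional {C F : PointedCone ℝ E} (l : E →ₗ[ℝ] ℝ) (hle : F ≤ C)
    (hl : ∀ x ∈ C, 0 ≤ l x) (hF : ∀ x ∈ C, x ∈ F ↔ l x = 0) : F.IsFaceOf C := by
  refine .of_mem_of_add_mem_left hle fun {x y} hx hy hxy => (hF x hx).2 ?_
  have h := (hF _ (hle hxy)).1 hxy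
  rw [map_add] at h
  linarith [hl x hx, hl y hy]

theorem isFaceOf_bot {C : PointedCone ℝ E} (hC : (C : ConvexCone ℝ E).Salient) :
    (⊥ : PointedCone ℝ E).IsFaceOf C := by
  refine .of_mem_of_add_mem_left bot_le fun {x y} hx hy hxy => ?_
  rw [Submodule.mem_bot] at hxy ⊢
  by_contra h
  refine hC x hx h ?_
  rw [neg_eq_of_add_eq_zero_right hxy]
  exact hy

theorem PointedCone.IsFaceOf.of_le {C D F : PointedCone ℝ E} (h : F.IsFaceOf C) (hF : F ≤ D)
    (hD : D ≤ C) : F.IsFaceOf D :=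
  ⟨hF, fun hx hy ha hxy => h.mem_of_smul_add_mem (hD hx) (hD hy) ha hxy⟩

theorem salient_of_le {C D : PointedCone ℝ E} (h : C ≤ D) (hD : (D : ConvexCone ℝ E).Salient) :
    (C : ConvexCone ℝ E).Salient :=
  fun x hx hx0 hnx => hD x (h hx) hx0 (h hnx)

/-- A finitely generated salient cone is generated by vectors spanning extreme rays. -/
theorem exists_extreme_generators (S : Finset E)
    (hS : ((hull ℝ (S : Set E) : PointedCone ℝ E) : ConvexCone ℝ E).Salient) :
    ∃ T ⊆ S, hull ℝ (T : Set E) = hull ℝ (S : Set E) ∧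
      ∀ t ∈ T, t ≠ 0 ∧ (hull ℝ {t}).IsFaceOf (hull ℝ (S : Set E)) := by
  classical
  -- In a generating subset of least cardinality no member lies in the cone over the others.
  obtain ⟨T, hT, hmin⟩ := Finset.exists_min_image
    (S.powerset.filter fun T : Finset E => hull ℝ (T : Set E) = hull ℝ (S : Set E)) Finset.card
    ⟨S, by simp⟩
  simp only [Finset.mem_filter, Finset.mem_powerset] at hT hmin
  refine ⟨T, hT.1, hT.2, fun t ht => ?_⟩
  have hnot : t ∉ hull ℝ ((T.erase t : Finset E) : Set E) := by
    intro h
    have h1 : hull ℝ ((T.erase t : Finset E) : Set E) = hull ℝ (T : Set E) := by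
      refine le_antisymm (Submodule.span_mono (by simp)) (Submodule.span_le.2 fun x hx => ?_)
      by_cases hxt : x = t
      · rw [hxt]; exact h
      · exact subset_hull (by simpa [hxt] using hx)
    have := hmin _ ⟨(Finset.erase_subset _ _).trans hT.1, h1.trans hT.2⟩
    have := Finset.card_erase_lt_of_mem ht
    omega
  rw [← hT.2] at hS ⊢
  have hins : (T : Set E) = insert t ((T.erase t : Finset E) : Set E) := by
    ext x; by_cases h : x = t <;> simp [h, ht]
  refine ⟨fun h0 => hnot (h0 ▸ zero_mem _), .of_mem_of_add_mem_left
    (Submodule.span_mono (by simpa using ht)) fun {x y} hx hy hxy => ?_⟩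
  have ht' : t ∈ hull ℝ (T : Set E) := subset_hull ht
  have hsub : hull ℝ ((T.erase t : Finset E) : Set E) ≤ hull ℝ (T : Set E) :=
    Submodule.span_mono (by simp)
  have hx' := hx
  have hy' := hy
  rw [hins, Submodule.mem_span_insert] at hx' hy'
  obtain ⟨a, x', hx', rfl⟩ := hx'
  obtain ⟨b, y', hy', rfl⟩ := hy'
  obtain ⟨c, hc, hxy⟩ := (mem_hull_singleton_iff _ _).1 hxy
  have hxy' : x' + y' = (c - a.1 - b.1) • t := by
    have e1 : a • t = a.1 • t := rfl
    have e2 : b • t = b.1 • t := rfl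
    rw [e1, e2] at hxy
    rw [sub_smul, sub_smul, hxy]
    abel
  have hx0 : x' = 0 := by
    by_contra h0
    -- Here x' + y' is a multiple of t. A positive coefficient would make t redundant; otherwise -x'
    -- lies in the cone, against salience.
    rcases lt_or_ge 0 (c - a.1 - b.1) with hpos | hneg
    · apply hnot
      rw [← PointedCone.smul_mem_iff _ hpos, ← hxy']
      exact add_mem hx' hy'
    · refine hS x' (hsub hx') h0 ?_
      have : -x' = y' + (-(c - a.1 - b.1)) • t := by
        rw [neg_smul, ← hxy']; abel
      rw [this]
      exact add_mem (hsub hy') (PointedCone.smul_mem _ (by linarith) ht')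
  rw [hx0, add_zero]
  exact Submodule.smul_mem _ _ (subset_hull rfl)

theorem span_hull (S : Set E) :
    Submodule.span ℝ ((hull ℝ S : PointedCone ℝ E) : Set E) = Submodule.span ℝ S :=
  le_antisymm (Submodule.span_le.2 (hull_le_span ℝ S)) (Submodule.span_mono subset_hull)

end Cones

/-! ### Rays and faces of fans. -/

section Fans

open PointedCone

variable {n : ℕ}

theorem coneDim_hull_singleton {v : Fin n → ℝ} (hv : v ≠ 0) : coneDim (hull ℝ {v}) = 1 := by
  rw [coneDim, span_hull, finrank_span_singleton hv]

theorem eq_hull_singleton_of_coneDim_eq_one {σ : PointedCone ℝ (Fin n → ℝ)}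
    (hσ : (σ : ConvexCone ℝ (Fin n → ℝ)).Salient) (hd : coneDim σ = 1) {v : Fin n → ℝ}
    (hv : v ∈ σ) (hv0 : v ≠ 0) : σ = hull ℝ {v} := by
  refine le_antisymm (fun x hx => ?_) (Submodule.span_le.2 (by simpa using hv))
  have hvs : v ∈ Submodule.span ℝ (σ : Set (Fin n → ℝ)) := Submodule.subset_span hv
  have hxs : x ∈ Submodule.span ℝ (σ : Set (Fin n → ℝ)) := Submodule.subset_span hx
  obtain ⟨c, hc⟩ := (finrank_eq_one_iff_of_nonzero'
    (⟨v, hvs⟩ : Submodule.span ℝ (σ : Set (Fin n → ℝ))) (by simpa using hv0)).1 hd ⟨x, hxs⟩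
  have hc : c • v = x := congrArg Subtype.val hc
  rw [mem_hull_singleton_iff]
  by_cases h : 0 ≤ c
  · exact ⟨c, h, hc⟩
  · exfalso
    push Not at h
    refine hσ v hv hv0 ?_
    have : -v = (-c)⁻¹ • x := by
      rw [← hc, smul_smul, inv_neg, neg_mul, inv_mul_cancel₀ h.ne, neg_one_smul]
    rw [this]
    exact PointedCone.smul_mem _ (inv_nonneg.2 (by linarith)) hx

theorem exists_mem_ne_zero_of_coneDim_eq_one {σ : PointedCone ℝ (Fin n → ℝ)}
    (hd : coneDim σ = 1) : ∃ v ∈ σ, v ≠ 0 := by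
  by_contra! h
  have : Submodule.span ℝ (σ : Set (Fin n → ℝ)) = ⊥ := by
    rw [Submodule.span_eq_bot]; exact h
  rw [coneDim, this, finrank_bot] at hd
  exact one_ne_zero hd.symm

theorem IsRationalPolyhedral.exists_generators {σ : PointedCone ℝ (Fin n → ℝ)}
    (hσ : IsRationalPolyhedral σ) : ∃ S : Finset (Fin n → ℝ), σ = hull ℝ (S : Set (Fin n → ℝ)) := by
  classical
  obtain ⟨S, rfl⟩ := hσ
  exact ⟨S.image latticeVec, by simp⟩

theorem IsFan.bot_mem {Δ : Set (PointedCone ℝ (Fin n → ℝ))} (h : IsFan Δ) : ⊥ ∈ Δ := by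
  obtain ⟨σ, hσ⟩ := h.nonempty
  exact h.face_mem σ hσ _ (isFaceOf_bot (h.salient σ hσ))

/-- Every cone of a fan is the sum of the rays of the fan that are faces of it. -/
theorem IsFan.eq_sSup_rays {Δ : Set (PointedCone ℝ (Fin n → ℝ))} (h : IsFan Δ)
    {σ : PointedCone ℝ (Fin n → ℝ)} (hσ : σ ∈ Δ) :
    σ = sSup {ρ | ρ ∈ fanRays Δ ∧ ρ.IsFaceOf σ} := by
  refine le_antisymm ?_ (sSup_le fun ρ hρ => hρ.2.le)
  obtain ⟨S, hS⟩ := (h.rational σ hσ).exists_generators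
  have hsal := h.salient σ hσ
  rw [hS] at hsal
  obtain ⟨T, -, hT, hface⟩ := exists_extreme_generators S hsal
  rw [← hS] at hT hface
  conv_lhs => rw [← hT]
  refine Submodule.span_le.2 fun t ht => ?_
  have : hull ℝ {t} ≤ sSup {ρ | ρ ∈ fanRays Δ ∧ ρ.IsFaceOf σ} :=
    le_sSup ⟨⟨h.face_mem σ hσ _ (hface t ht).2, coneDim_hull_singleton (hface t ht).1⟩,
      (hface t ht).2⟩
  exact this (subset_hull rfl)

/-- Two faces of cones that meet in a common face meet in a common face. -/
theorem PointedCone.IsFaceOf.inf_of_common {C D σ τ : PointedCone ℝ (Fin n → ℝ)}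
    (hσ : σ.IsFaceOf C) (hτ : τ.IsFaceOf D) (hC : (C ⊓ D).IsFaceOf C) (hD : (C ⊓ D).IsFaceOf D) :
    (σ ⊓ τ).IsFaceOf σ := by
  have h1 : (σ ⊓ (C ⊓ D)).IsFaceOf C := hσ.inf_left hC
  have h2 : (τ ⊓ (C ⊓ D)).IsFaceOf (C ⊓ D) :=
    (hτ.inf_left hD).of_le inf_le_right inf_le_right
  -- σ ⊓ τ is the intersection of the traces of σ and τ on C ⊓ D, and both traces are faces of C ⊓
  -- D.
  have h3 : (σ ⊓ τ).IsFaceOf (C ⊓ D) := by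
    have h4 := (h1.of_le inf_le_right inf_le_left).inf_left h2
    have : σ ⊓ (C ⊓ D) ⊓ (τ ⊓ (C ⊓ D)) = σ ⊓ τ := by
      apply le_antisymm
      · exact le_inf (inf_le_left.trans inf_le_left) (inf_le_right.trans inf_le_left)
      · exact le_inf (le_inf inf_le_left (inf_le_inf hσ.le hτ.le))
          (le_inf inf_le_right (inf_le_inf hσ.le hτ.le))
    rwa [this] at h4
  exact (h3.trans hC).of_le inf_le_left hσ.le

theorem isRationalPolyhedral_of_isFaceOf {σ τ : PointedCone ℝ (Fin n → ℝ)}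
    (hσ : IsRationalPolyhedral σ) (hτ : τ.IsFaceOf σ) : IsRationalPolyhedral τ := by
  classical
  obtain ⟨S, rfl⟩ := hσ
  refine ⟨S.filter fun s => latticeVec s ∈ τ, ?_⟩
  conv_lhs => rw [hτ.eq_hull_inter]
  congr 1
  ext x
  simp only [Set.mem_inter_iff, Set.mem_image, Finset.coe_filter, Set.mem_ofPred_eq,
    SetLike.mem_coe]
  constructor
  · rintro ⟨⟨s, hs, rfl⟩, h⟩
    exact ⟨s, ⟨hs, h⟩, rfl⟩
  · rintro ⟨s, ⟨hs, h⟩, rfl⟩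
    exact ⟨⟨s, hs, rfl⟩, h⟩

theorem IsRationalPolyhedral.finite_faces {σ : PointedCone ℝ (Fin n → ℝ)}
    (hσ : IsRationalPolyhedral σ) : {τ : PointedCone ℝ (Fin n → ℝ) | τ.IsFaceOf σ}.Finite := by
  obtain ⟨S, rfl⟩ := hσ.exists_generators
  refine ((S.finite_toSet.finite_subsets).image (fun T => hull ℝ T)).subset fun τ hτ => ?_
  exact ⟨(S : Set (Fin n → ℝ)) ∩ τ, Set.inter_subset_left, hτ.eq_hull_inter.symm⟩

end Fans

/-! ### Support functions and normal fans. -/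

section Support

open PointedCone

variable {n : ℕ}

/-- The rational vector `q ∈ ℚⁿ`, seen in `ℝⁿ`. -/
def ratVec (q : Fin n → ℚ) : Fin n → ℝ := fun i => (q i : ℝ)

/-- `Δ` carries a strictly convex piecewise linear support function: every cone `σ` has a rational
functional `m σ` that on `σ` is minimal among all of them, exactly on `σ`. -/
def HasStrictSupport (Δ : Set (PointedCone ℝ (Fin n → ℝ))) : Prop :=
  ∃ m : PointedCone ℝ (Fin n → ℝ) → Fin n → ℚ, ∀ σ ∈ Δ, ∀ τ ∈ Δ, ∀ x ∈ σ,
    ratVec (m σ) ⬝ᵥ x ≤ ratVec (m τ) ⬝ᵥ x ∧ (ratVec (m τ) ⬝ᵥ x ≤ ratVec (m σ) ⬝ᵥ x → x ∈ τ)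

theorem exists_dotProduct_eq (l : (Fin n → ℝ) →ₗ[ℝ] ℝ) : ∃ u : Fin n → ℝ, ∀ x, l x = x ⬝ᵥ u := by
  refine ⟨fun i => l (Pi.single i 1), fun x => ?_⟩
  conv_lhs => rw [← Finset.univ_sum_single x]
  rw [map_sum, dotProduct]
  refine Finset.sum_congr rfl fun i _ => ?_
  rw [← smul_eq_mul, ← map_smul]
  congr 1
  ext j
  by_cases h : j = i
  · subst h; simp
  · simp [h]

/-- The points of `P` at which the pairing with `u` is minimal form an exposed face. -/
theorem isExposed_minimizers (P : Set (Fin n → ℝ)) (u : Fin n → ℝ) :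
    IsExposed ℝ P {p | p ∈ P ∧ ∀ q ∈ P, p ⬝ᵥ u ≤ q ⬝ᵥ u} := by
  intro _
  refine ⟨-(LinearMap.toContinuousLinearMap ((dotProductBilin ℝ ℝ).flip u)), ?_⟩
  ext p
  simp

theorem exists_minimizers {P F : Set (Fin n → ℝ)} (hF : IsExposed ℝ P F) (hne : F.Nonempty) :
    ∃ u : Fin n → ℝ, F = {p | p ∈ P ∧ ∀ q ∈ P, p ⬝ᵥ u ≤ q ⬝ᵥ u} := by
  obtain ⟨l, rfl⟩ := hF hne
  obtain ⟨u, hu⟩ := exists_dotProduct_eq (-(l : (Fin n → ℝ) →ₗ[ℝ] ℝ))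
  refine ⟨u, ?_⟩
  ext p
  simp [← hu]

/-- A polytope is compact, so x attains its minimum on it and lies in the normal cone of the
minimizing face. Consequently an incomplete fan is never projective. -/
theorem IsProjectiveFan.isCompleteFan {Δ : Set (PointedCone ℝ (Fin n → ℝ))}
    (h : IsProjectiveFan Δ) : IsCompleteFan Δ := by
  obtain ⟨P, ⟨S, hS, hP⟩, rfl⟩ := h
  intro x
  have hc : IsCompact P := by
    rw [hP]
    exact (S.finite_toSet.image _).isCompact_convexHull ℝ
  have hne : P.Nonempty := by
    rw [hP, convexHull_nonempty_iff]
    exact hS.to_set.image _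
  obtain ⟨p, hp, hmin⟩ := hc.exists_isMinOn hne
    (f := fun p => p ⬝ᵥ x) (by fun_prop)
  refine ⟨_, ⟨{p | p ∈ P ∧ ∀ q ∈ P, p ⬝ᵥ x ≤ q ⬝ᵥ x}, ⟨p, hp, fun q hq => hmin hq⟩,
    isExposed_minimizers P x, rfl⟩, ?_⟩
  exact fun m hm m' hm' => hm.2 m' hm'

/-- The polytope is the convex hull of the functionals m σ. Completeness is used to recognize τ: a
vector at which m τ is minimal lies in some σ, and strictness then puts it in τ. -/
theorem HasStrictSupport.isProjectiveFan {Δ : Set (PointedCone ℝ (Fin n → ℝ))} (hΔ : IsFan Δ)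
    (hc : IsCompleteFan Δ) (hs : HasStrictSupport Δ) : IsProjectiveFan Δ := by
  classical
  obtain ⟨m, hm⟩ := hs
  set S : Finset (Fin n → ℚ) := hΔ.finite.toFinset.image m with hSdef
  set P : Set (Fin n → ℝ) := convexHull ℝ (ratVec '' (S : Set (Fin n → ℚ))) with hPdef
  have hmP : ∀ σ ∈ Δ, ratVec (m σ) ∈ P := fun σ hσ =>
    subset_convexHull _ _ ⟨m σ, by simpa [hSdef] using ⟨σ, hσ, rfl⟩, rfl⟩
  have hle : ∀ σ ∈ Δ, ∀ x ∈ σ, ∀ p ∈ P, ratVec (m σ) ⬝ᵥ x ≤ p ⬝ᵥ x := by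
    intro σ hσ x hx
    have hconv : Convex ℝ {p : Fin n → ℝ | ratVec (m σ) ⬝ᵥ x ≤ p ⬝ᵥ x} :=
      convex_halfSpace_ge ⟨fun a b => add_dotProduct a b x, fun a b => smul_dotProduct a b x⟩ _
    refine fun p hp => convexHull_min ?_ hconv hp
    rintro _ ⟨q, hq, rfl⟩
    simp only [hSdef, Finset.coe_image, Set.mem_image, Set.Finite.coe_toFinset] at hq
    obtain ⟨τ, hτ, rfl⟩ := hq
    exact (hm σ hσ τ hτ x hx).1
  have hmem : ∀ τ ∈ Δ, ∀ x, (∀ p ∈ P, ratVec (m τ) ⬝ᵥ x ≤ p ⬝ᵥ x) → x ∈ τ := by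
    intro τ hτ x hx
    obtain ⟨σ, hσ, hxσ⟩ := hc x
    exact (hm σ hσ τ hτ x hxσ).2 (hx _ (hmP σ hσ))
  refine ⟨P, ⟨S, ?_, rfl⟩, Set.Subset.antisymm ?_ ?_⟩
  · obtain ⟨σ, hσ⟩ := hΔ.nonempty
    exact ⟨m σ, by simpa [hSdef] using ⟨σ, hσ, rfl⟩⟩
  · intro τ hτ
    obtain ⟨G, rfl⟩ := (hΔ.rational τ hτ).exists_generators
    set τ := hull ℝ (G : Set (Fin n → ℝ))
    -- The sum of the generators is a relative interior point of τ: a functional minimal there has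
    -- to agree with m τ on every generator. Its minimizing face therefore has normal cone τ.
    have hw : ∑ g ∈ G, g ∈ τ := Submodule.sum_mem _ fun g hg => subset_hull hg
    refine ⟨{p | p ∈ P ∧ ∀ q ∈ P, p ⬝ᵥ (∑ g ∈ G, g) ≤ q ⬝ᵥ (∑ g ∈ G, g)}, ⟨ratVec (m τ), hmP τ hτ, fun q hq => hle τ hτ _ hw q hq⟩,
      isExposed_minimizers P (∑ g ∈ G, g), ?_⟩
    refine le_antisymm (Submodule.span_le.2 fun g hg => ?_) fun x hx => ?_
    · rintro p ⟨hpP, hp⟩ q hq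
      have hgle : ∀ g ∈ G, ratVec (m τ) ⬝ᵥ g ≤ p ⬝ᵥ g := fun g hg =>
        hle τ hτ g (subset_hull hg) p hpP
      have hsum := hp _ (hmP τ hτ)
      rw [dotProduct_sum, dotProduct_sum] at hsum
      have heq := (Finset.sum_eq_sum_iff_of_le hgle).1 (le_antisymm (Finset.sum_le_sum hgle) hsum)
      rw [← heq g hg]
      exact hle τ hτ g (subset_hull hg) q hq
    · exact hmem τ hτ x fun p hp => hx _ ⟨hmP τ hτ, fun q hq => hle τ hτ _ hw q hq⟩ p hp
  · rintro _ ⟨F, hne, hF, rfl⟩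
    obtain ⟨u, rfl⟩ := exists_minimizers hF hne
    -- The normal cone of the face minimizing u is the smallest cone of the fan that contains u.
    obtain ⟨σ, ⟨hσ, huσ⟩, hmin⟩ := Set.Finite.exists_minimalFor id {σ | σ ∈ Δ ∧ u ∈ σ}
      (hΔ.finite.subset fun σ hσ => hσ.1) (by obtain ⟨σ, h⟩ := hc u; exact ⟨σ, h⟩)
    convert hσ
    refine le_antisymm (fun x hx => ?_) (fun x hx => ?_)
    · exact hmem σ hσ x fun p hp => hx _ ⟨hmP σ hσ, fun q hq => hle σ hσ _ huσ q hq⟩ p hp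
    · rintro p ⟨hpP, hp⟩ q hq
      let l : (Fin n → ℝ) →ₗ[ℝ] ℝ := dotProductBilin ℝ ℝ (p - ratVec (m σ))
      have hl : ∀ x, l x = p ⬝ᵥ x - ratVec (m σ) ⬝ᵥ x := fun x => by
        simp [l]
      -- The locus in σ where p agrees with m σ is a face containing u, hence all of σ by
      -- minimality.
      let G : PointedCone ℝ (Fin n → ℝ) := σ ⊓ PointedCone.ofSubmodule (LinearMap.ker l)
      have hG : G.IsFaceOf σ := by
        refine isFaceOf_of_functional l inf_le_left (fun x hx => ?_) (fun x hx => ?_)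
        · rw [hl]; linarith [hle σ hσ x hx p hpP]
        · simp [G, hx]
      have huG : u ∈ G := by
        refine ⟨huσ, ?_⟩
        change l u = 0
        rw [hl]
        linarith [hp _ (hmP σ hσ), hle σ hσ u huσ p hpP]
      have hxG : x ∈ G := hmin ⟨hΔ.face_mem σ hσ G hG, huG⟩ (inf_le_left : G ≤ σ) hx
      have hlx : l x = 0 := hxG.2
      rw [hl] at hlx
      linarith [hle σ hσ x hx q hq]

end Support

/-! ### Products with the fan of the projective line, and the induction on dimension. -/

section Suspension

open PointedCone

/-- The ray `ℝ≥0`, the origin, or the ray `ℝ≤0`, according to the sign `s`. -/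
def signCone (s : SignType) : PointedCone ℝ ℝ := hull ℝ {(s : ℝ)}

theorem mem_signCone_zero (x : ℝ) : x ∈ signCone 0 ↔ x = 0 := by
  simp [signCone]

theorem mem_signCone_one (x : ℝ) : x ∈ signCone 1 ↔ 0 ≤ x := by
  rw [signCone, mem_hull_singleton_iff]
  exact ⟨fun ⟨t, ht, h⟩ => by rw [← h]; simpa using ht, fun h => ⟨x, h, by simp⟩⟩

theorem mem_signCone_neg_one (x : ℝ) : x ∈ signCone (-1) ↔ x ≤ 0 := by
  rw [signCone, mem_hull_singleton_iff]
  exact ⟨fun ⟨t, ht, h⟩ => by rw [← h]; simpa using ht, fun h => ⟨-x, by linarith, by simp⟩⟩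

theorem SignType.eq_zero_or_one_or_neg_one (s : SignType) : s = 0 ∨ s = 1 ∨ s = -1 := by
  cases s <;> simp

theorem signCone_zero : signCone 0 = ⊥ := by
  ext x; rw [mem_signCone_zero, Submodule.mem_bot]

theorem salient_signCone (s : SignType) : (signCone s : ConvexCone ℝ ℝ).Salient := by
  intro x hx hx0 hnx
  simp only [PointedCone.mem_toConvexCone] at hx hnx
  apply hx0
  rcases s.eq_zero_or_one_or_neg_one with rfl | rfl | rfl
  · rwa [mem_signCone_zero] at hx
  · rw [mem_signCone_one] at hx hnx; linarith
  · rw [mem_signCone_neg_one] at hx hnx; linarith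

theorem bot_isFaceOf_signCone (s : SignType) : (⊥ : PointedCone ℝ ℝ).IsFaceOf (signCone s) :=
  isFaceOf_bot (salient_signCone s)

theorem eq_signCone_of_isFaceOf {s : SignType} {F : PointedCone ℝ ℝ}
    (hF : F.IsFaceOf (signCone s)) : ∃ t, F = signCone t := by
  have h := hF.eq_hull_inter
  by_cases hs : (s : ℝ) ∈ F
  · refine ⟨s, h.trans ?_⟩
    rw [signCone, Set.inter_eq_left.2 (by simpa using hs)]
  · refine ⟨0, h.trans ?_⟩
    rw [signCone_zero, Set.singleton_inter_eq_empty.2 hs]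
    exact Submodule.span_empty

theorem signCone_inf_isFaceOf (s t : SignType) :
    (signCone s ⊓ signCone t).IsFaceOf (signCone s) := by
  by_cases h : s = t
  · subst h; rw [inf_idem]
  · convert bot_isFaceOf_signCone s
    rw [eq_bot_iff]
    rintro x ⟨hx, hx'⟩
    rw [Submodule.mem_bot]
    simp only [SetLike.mem_coe] at hx hx'
    rcases s.eq_zero_or_one_or_neg_one with rfl | rfl | rfl <;>
    rcases t.eq_zero_or_one_or_neg_one with rfl | rfl | rfl <;>
    simp only [mem_signCone_zero, mem_signCone_one, mem_signCone_neg_one] at hx hx' <;>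
    first
      | exact absurd rfl h
      | linarith

variable {n : ℕ}

/-- The projection `ℝⁿ⁺¹ → ℝⁿ` forgetting the first coordinate. -/
def tailMap (n : ℕ) : (Fin (n + 1) → ℝ) →ₗ[ℝ] (Fin n → ℝ) := LinearMap.funLeft ℝ ℝ Fin.succ

/-- The inclusion `ℝⁿ → ℝⁿ⁺¹` with first coordinate zero. -/
def consMap (n : ℕ) : (Fin n → ℝ) →ₗ[ℝ] (Fin (n + 1) → ℝ) where
  toFun u := Fin.cons 0 u
  map_add' u v := by
    ext i
    refine Fin.cases ?_ (fun i => ?_) i <;> simp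
  map_smul' c u := by
    ext i
    refine Fin.cases ?_ (fun i => ?_) i <;> simp

/-- The inclusion `ℝ → ℝⁿ⁺¹` of the first coordinate axis. -/
def axisMap (n : ℕ) : ℝ →ₗ[ℝ] (Fin (n + 1) → ℝ) := LinearMap.single ℝ (fun _ => ℝ) 0

@[simp] theorem tailMap_apply (x : Fin (n + 1) → ℝ) (i : Fin n) : tailMap n x i = x i.succ := rfl

@[simp] theorem consMap_zero (u : Fin n → ℝ) : consMap n u 0 = 0 := rfl

@[simp] theorem consMap_succ (u : Fin n → ℝ) (i : Fin n) : consMap n u i.succ = u i := rfl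

@[simp] theorem axisMap_zero (t : ℝ) : axisMap n t 0 = t := by simp [axisMap]

@[simp] theorem axisMap_succ (t : ℝ) (i : Fin n) : axisMap n t i.succ = 0 := by simp [axisMap]

@[simp] theorem tailMap_consMap (u : Fin n → ℝ) : tailMap n (consMap n u) = u := rfl

@[simp] theorem tailMap_axisMap (t : ℝ) : tailMap n (axisMap n t) = 0 := by ext i; simp

theorem consMap_add_axisMap (x : Fin (n + 1) → ℝ) :
    consMap n (tailMap n x) + axisMap n (x 0) = x := by
  ext i
  refine Fin.cases ?_ (fun i => ?_) i <;> simp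

theorem consMap_injective : Function.Injective (consMap n) :=
  Function.LeftInverse.injective (g := tailMap n) tailMap_consMap

/-- The product cone `C × σ` in `ℝⁿ⁺¹ = ℝ × ℝⁿ`. -/
def prodCone (σ : PointedCone ℝ (Fin n → ℝ)) (C : PointedCone ℝ ℝ) :
    PointedCone ℝ (Fin (n + 1) → ℝ) :=
  σ.comap (tailMap n) ⊓ C.comap (LinearMap.proj 0)

theorem mem_prodCone {σ : PointedCone ℝ (Fin n → ℝ)} {C : PointedCone ℝ ℝ}
    {x : Fin (n + 1) → ℝ} : x ∈ prodCone σ C ↔ tailMap n x ∈ σ ∧ x 0 ∈ C := Iff.rfl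

theorem consMap_mem_prodCone {σ : PointedCone ℝ (Fin n → ℝ)} {C : PointedCone ℝ ℝ}
    {u : Fin n → ℝ} : consMap n u ∈ prodCone σ C ↔ u ∈ σ := by
  simp [mem_prodCone]

theorem axisMap_mem_prodCone {σ : PointedCone ℝ (Fin n → ℝ)} {C : PointedCone ℝ ℝ}
    {t : ℝ} : axisMap n t ∈ prodCone σ C ↔ t ∈ C := by
  simp [mem_prodCone]

theorem comap_consMap_prodCone (σ : PointedCone ℝ (Fin n → ℝ)) (C : PointedCone ℝ ℝ) :
    (prodCone σ C).comap (consMap n) = σ := by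
  ext u
  exact consMap_mem_prodCone

theorem prodCone_bot_injective :
    Function.Injective fun σ : PointedCone ℝ (Fin n → ℝ) => prodCone σ ⊥ := fun σ τ h => by
  rw [← comap_consMap_prodCone σ ⊥, ← comap_consMap_prodCone τ ⊥]
  exact congrArg _ h

theorem prodCone_inf (σ τ : PointedCone ℝ (Fin n → ℝ)) (C D : PointedCone ℝ ℝ) :
    prodCone σ C ⊓ prodCone τ D = prodCone (σ ⊓ τ) (C ⊓ D) := by
  ext x
  simp only [Submodule.mem_inf, mem_prodCone]
  tauto

theorem prodCone_mono {σ τ : PointedCone ℝ (Fin n → ℝ)} {C D : PointedCone ℝ ℝ}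
    (h : σ ≤ τ) (h' : C ≤ D) : prodCone σ C ≤ prodCone τ D :=
  fun _ hx => ⟨h hx.1, h' hx.2⟩

theorem prodCone_bot_bot : prodCone (⊥ : PointedCone ℝ (Fin n → ℝ)) ⊥ = ⊥ := by
  ext x
  rw [mem_prodCone, Submodule.mem_bot, Submodule.mem_bot, Submodule.mem_bot]
  constructor
  · rintro ⟨h1, h2⟩
    rw [← consMap_add_axisMap x, h1, h2]
    simp
  · rintro rfl
    simp

theorem prodCone_isFaceOf {σ τ : PointedCone ℝ (Fin n → ℝ)} {C D : PointedCone ℝ ℝ}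
    (h : τ.IsFaceOf σ) (h' : D.IsFaceOf C) : (prodCone τ D).IsFaceOf (prodCone σ C) :=
  (h.comap _).inf (h'.comap _)

/-- The horizontal and the vertical part of a point of the product cone lie in that cone, so a face
contains the point exactly when it contains both parts. -/
theorem eq_prodCone_of_isFaceOf {σ : PointedCone ℝ (Fin n → ℝ)} {C : PointedCone ℝ ℝ}
    {F : PointedCone ℝ (Fin (n + 1) → ℝ)} (hF : F.IsFaceOf (prodCone σ C)) :
    ∃ τ D, τ.IsFaceOf σ ∧ D.IsFaceOf C ∧ F = prodCone τ D := by
  refine ⟨F.comap (consMap n), F.comap (axisMap n), ?_, ?_, ?_⟩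
  · have := hF.comap (consMap n)
    rwa [comap_consMap_prodCone] at this
  · have := hF.comap (axisMap n)
    convert this
    ext t
    exact axisMap_mem_prodCone.symm
  · ext x
    rw [mem_prodCone, mem_comap, mem_comap]
    constructor
    · intro hx
      have hx' := hF.le hx
      have h1 : consMap n (tailMap n x) ∈ prodCone σ C := consMap_mem_prodCone.2 hx'.1
      have h2 : axisMap n (x 0) ∈ prodCone σ C := axisMap_mem_prodCone.2 hx'.2
      rw [← hF.add_mem_iff_mem h1 h2, consMap_add_axisMap]
      exact hx
    · rintro ⟨h1, h2⟩
      rw [← consMap_add_axisMap x]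
      exact add_mem h1 h2

theorem prodCone_bot_eq_map (σ : PointedCone ℝ (Fin n → ℝ)) :
    prodCone σ ⊥ = σ.map (consMap n) := by
  ext x
  rw [mem_prodCone, mem_map, Submodule.mem_bot]
  constructor
  · rintro ⟨h1, h2⟩
    refine ⟨_, h1, ?_⟩
    conv_rhs => rw [← consMap_add_axisMap x, h2]
    simp
  · rintro ⟨u, hu, rfl⟩
    simpa using hu

theorem coneDim_prodCone_bot (σ : PointedCone ℝ (Fin n → ℝ)) :
    coneDim (prodCone σ ⊥) = coneDim σ := by
  rw [prodCone_bot_eq_map, coneDim, coneDim, coe_map, Submodule.span_image]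
  exact (Submodule.equivMapOfInjective (consMap n) consMap_injective _).finrank_eq.symm

theorem prodCone_hull (S : Set (Fin n → ℝ)) (T : Set ℝ) :
    prodCone (hull ℝ S) (hull ℝ T) = hull ℝ (consMap n '' S ∪ axisMap n '' T) := by
  refine le_antisymm (fun x hx => ?_) (Submodule.span_le.2 ?_)
  · rw [← consMap_add_axisMap x, mem_prodCone] at *
    have h1 : hull ℝ S ≤ (hull ℝ (consMap n '' S ∪ axisMap n '' T)).comap (consMap n) :=
      Submodule.span_le.2 fun u hu => subset_hull (Or.inl ⟨u, hu, rfl⟩)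
    have h2 : hull ℝ T ≤ (hull ℝ (consMap n '' S ∪ axisMap n '' T)).comap (axisMap n) :=
      Submodule.span_le.2 fun u hu => subset_hull (Or.inr ⟨u, hu, rfl⟩)
    refine add_mem (h1 ?_) (h2 ?_)
    · simpa using hx.1
    · simpa using hx.2
  · rintro _ (⟨u, hu, rfl⟩ | ⟨t, ht, rfl⟩)
    · exact consMap_mem_prodCone.2 (subset_hull hu)
    · exact axisMap_mem_prodCone.2 (subset_hull ht)

/-- The lattice vector `(z, u)` in `ℤⁿ⁺¹`. -/
theorem latticeVec_cons (z : ℤ) (u : Fin n → ℤ) :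
    latticeVec (Fin.cons z u : Fin (n + 1) → ℤ) = consMap n (latticeVec u) + axisMap n z := by
  ext i
  refine Fin.cases ?_ (fun i => ?_) i <;> simp [latticeVec]

theorem isRationalPolyhedral_prodCone {σ : PointedCone ℝ (Fin n → ℝ)}
    (h : IsRationalPolyhedral σ) (s : SignType) :
    IsRationalPolyhedral (prodCone σ (signCone s)) := by
  classical
  obtain ⟨S, rfl⟩ := h
  refine ⟨S.image (fun u => Fin.cons 0 u) ∪ {Fin.cons (s : ℤ) 0}, ?_⟩
  rw [signCone, prodCone_hull]
  congr 1
  have h0 : latticeVec (0 : Fin n → ℤ) = 0 := by ext; simp [latticeVec]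
  ext x
  simp [latticeVec_cons, h0, @eq_comm _ x]

/-- The suspension of a fan `Δ` in `ℝⁿ`: the product of `Δ` with the fan of the projective line. -/
def suspension (Δ : Set (PointedCone ℝ (Fin n → ℝ))) : Set (PointedCone ℝ (Fin (n + 1) → ℝ)) :=
  {σ' | ∃ σ ∈ Δ, ∃ s, σ' = prodCone σ (signCone s)}

/-- The rays of a set `R` together with both rays of the first coordinate axis. -/
def suspensionRays (R : Set (PointedCone ℝ (Fin n → ℝ))) :
    Set (PointedCone ℝ (Fin (n + 1) → ℝ)) :=
  (fun ρ => prodCone ρ ⊥) '' R ∪ {prodCone ⊥ (signCone 1), prodCone ⊥ (signCone (-1))}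

/-- The part of a fan that lies in the hyperplane `x₀ = 0`. -/
def equator (Δ' : Set (PointedCone ℝ (Fin (n + 1) → ℝ))) : Set (PointedCone ℝ (Fin n → ℝ)) :=
  {σ | prodCone σ ⊥ ∈ Δ'}

theorem salient_prodCone {σ : PointedCone ℝ (Fin n → ℝ)} {C : PointedCone ℝ ℝ}
    (h : (σ : ConvexCone ℝ (Fin n → ℝ)).Salient) (h' : (C : ConvexCone ℝ ℝ).Salient) :
    (prodCone σ C : ConvexCone ℝ (Fin (n + 1) → ℝ)).Salient := by
  intro x hx hx0 hnx
  rw [PointedCone.mem_toConvexCone, mem_prodCone] at hx hnx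
  apply hx0
  rw [← consMap_add_axisMap x]
  have h1 : tailMap n x = 0 := by
    by_contra h0
    exact h _ hx.1 h0 (by simpa using hnx.1)
  have h2 : x 0 = 0 := by
    by_contra h0
    exact h' _ hx.2 h0 (by simpa using hnx.2)
  rw [h1, h2]
  simp

theorem IsFan.suspension {Δ : Set (PointedCone ℝ (Fin n → ℝ))} (h : IsFan Δ) :
    IsFan (suspension Δ) where
  finite := by
    refine (h.finite.image2 (fun σ s => prodCone σ (signCone s)) Set.finite_univ).subset ?_
    rintro _ ⟨σ, hσ, s, rfl⟩
    exact ⟨σ, hσ, s, Set.mem_univ s, rfl⟩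
  nonempty := by
    obtain ⟨σ, hσ⟩ := h.nonempty
    exact ⟨_, σ, hσ, 0, rfl⟩
  rational := by
    rintro _ ⟨σ, hσ, s, rfl⟩
    exact isRationalPolyhedral_prodCone (h.rational σ hσ) s
  salient := by
    rintro _ ⟨σ, hσ, s, rfl⟩
    exact salient_prodCone (h.salient σ hσ) (salient_signCone s)
  face_mem := by
    rintro _ ⟨σ, hσ, s, rfl⟩ F hF
    obtain ⟨τ, D, hτ, hD, rfl⟩ := eq_prodCone_of_isFaceOf hF
    obtain ⟨t, rfl⟩ := eq_signCone_of_isFaceOf hD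
    exact ⟨τ, h.face_mem σ hσ τ hτ, t, rfl⟩
  inter_left := by
    rintro _ ⟨σ, hσ, s, rfl⟩ _ ⟨τ, hτ, t, rfl⟩
    rw [prodCone_inf]
    exact prodCone_isFaceOf (h.inter_left σ hσ τ hτ) (signCone_inf_isFaceOf s t)
  inter_right := by
    rintro _ ⟨σ, hσ, s, rfl⟩ _ ⟨τ, hτ, t, rfl⟩
    rw [prodCone_inf]
    refine prodCone_isFaceOf (h.inter_right σ hσ τ hτ) ?_
    rw [inf_comm]
    exact signCone_inf_isFaceOf t s

theorem fanRays_suspension_subset {Δ R : Set (PointedCone ℝ (Fin n → ℝ))} (h : IsFan Δ)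
    (hR : fanRays Δ ⊆ R) : fanRays (suspension Δ) ⊆ suspensionRays R := by
  rintro _ ⟨⟨σ, hσ, s, rfl⟩, hd⟩
  by_cases hs : s = 0
  · subst hs
    rw [signCone_zero] at hd ⊢
    exact Or.inl ⟨σ, hR ⟨hσ, by rwa [coneDim_prodCone_bot] at hd⟩, rfl⟩
  · right
    have hs' : (s : ℝ) ≠ 0 := by
      rcases s.eq_zero_or_one_or_neg_one with rfl | rfl | rfl <;> simp at hs ⊢
    have hmem : axisMap n (s : ℝ) ∈ prodCone σ (signCone s) :=
      axisMap_mem_prodCone.2 (subset_hull rfl)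
    have h0 : axisMap n (s : ℝ) ≠ 0 := fun h => hs' (by
      have := congrFun h 0
      simpa using this)
    have heq := eq_hull_singleton_of_coneDim_eq_one
      (salient_prodCone (h.salient σ hσ) (salient_signCone s)) hd hmem h0
    have hσ0 : σ = ⊥ := by
      rw [eq_bot_iff]
      intro u hu
      have h1 : consMap n u ∈ prodCone σ (signCone s) := consMap_mem_prodCone.2 hu
      rw [heq, mem_hull_singleton_iff] at h1
      obtain ⟨t, -, h1⟩ := h1
      have h2 := congrArg (tailMap n) h1
      simpa [eq_comm] using h2
    rw [hσ0]
    rcases s.eq_zero_or_one_or_neg_one with rfl | rfl | rfl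
    · exact absurd rfl hs
    · exact Or.inl rfl
    · exact Or.inr rfl

theorem equator_suspension {Δ : Set (PointedCone ℝ (Fin n → ℝ))} :
    equator (suspension Δ) = Δ := by
  ext σ
  constructor
  · rintro ⟨τ, hτ, s, h⟩
    have := congrArg (PointedCone.comap (consMap n)) h
    rw [comap_consMap_prodCone, comap_consMap_prodCone] at this
    rwa [this]
  · intro h
    exact ⟨σ, h, 0, by rw [signCone_zero]⟩

theorem IsFan.equator {Δ' : Set (PointedCone ℝ (Fin (n + 1) → ℝ))} (h : IsFan Δ') :
    IsFan (equator Δ') where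
  finite := h.finite.preimage prodCone_bot_injective.injOn
  nonempty := ⟨⊥, by
    change prodCone ⊥ ⊥ ∈ Δ'
    rw [prodCone_bot_bot]
    exact h.bot_mem⟩
  rational := by
    classical
    intro σ hσ
    obtain ⟨S, hS⟩ := h.rational _ hσ
    refine ⟨S.image fun v i => v i.succ, ?_⟩
    have h1 : σ = (prodCone σ ⊥).map (tailMap n) := by
      rw [prodCone_bot_eq_map, map_map]
      have : tailMap n ∘ₗ consMap n = LinearMap.id := by ext; simp
      rw [this, map_id]
    rw [h1, hS, PointedCone.map, Submodule.map_span]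
    congr 1
    ext x
    simp only [Set.mem_image, Finset.coe_image, exists_exists_and_eq_and, SetLike.mem_coe]
    rfl
  salient := by
    intro σ hσ x hx hx0 hnx
    refine h.salient _ hσ (consMap n x) (consMap_mem_prodCone.2 hx)
      (fun h0 => hx0 (consMap_injective (by rw [h0, map_zero]))) ?_
    rw [← map_neg]
    exact consMap_mem_prodCone.2 hnx
  face_mem := fun σ hσ τ hτ => h.face_mem _ hσ _ (prodCone_isFaceOf hτ (.refl _))
  inter_left := by
    intro σ hσ τ hτ
    have := (h.inter_left _ hσ _ hτ).comap (consMap n)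
    rwa [prodCone_inf, comap_consMap_prodCone, comap_consMap_prodCone] at this
  inter_right := by
    intro σ hσ τ hτ
    have := (h.inter_right _ hσ _ hτ).comap (consMap n)
    rwa [prodCone_inf, comap_consMap_prodCone, comap_consMap_prodCone] at this

theorem fanRays_equator_subset {Δ' : Set (PointedCone ℝ (Fin (n + 1) → ℝ))}
    {R : Set (PointedCone ℝ (Fin n → ℝ))} (hR : fanRays Δ' ⊆ suspensionRays R) :
    fanRays (equator Δ') ⊆ R := by
  rintro ρ ⟨hρ, hd⟩
  have hne : ∀ t : ℝ, t ≠ 0 → ∀ C : PointedCone ℝ ℝ, t ∈ C → prodCone ρ ⊥ ≠ prodCone ⊥ C := by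
    intro t ht C htC h
    have : axisMap n t ∈ prodCone ρ ⊥ := by
      rw [h]; exact axisMap_mem_prodCone.2 htC
    rw [axisMap_mem_prodCone, Submodule.mem_bot] at this
    exact ht this
  rcases hR ⟨hρ, (coneDim_prodCone_bot ρ).trans hd⟩ with ⟨ρ', hρ', h⟩ | h | h
  · rwa [← prodCone_bot_injective h]
  · exact absurd h (hne 1 one_ne_zero _ ((mem_signCone_one _).2 zero_le_one))
  · exact absurd h (hne (-1) (by norm_num) _ ((mem_signCone_neg_one _).2 (by norm_num)))

/-- A cone of the fan is generated by its rays, each of which is horizontal or one of the two axis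
rays; salience excludes having both axis rays. The cone is therefore its horizontal part times some
`signCone s`, and the horizontal part is one of its faces. -/
theorem subset_suspension_equator {Δ' : Set (PointedCone ℝ (Fin (n + 1) → ℝ))}
    {R : Set (PointedCone ℝ (Fin n → ℝ))} (h : IsFan Δ') (hR : fanRays Δ' ⊆ suspensionRays R) :
    Δ' ⊆ suspension (equator Δ') := by
  intro σ' hσ'
  have hex : ∃ s : SignType, prodCone ⊥ (signCone s) ≤ σ' ∧
      ∀ t : SignType, prodCone ⊥ (signCone t) ≤ σ' → signCone t ≤ signCone s := by
    by_cases h1 : prodCone ⊥ (signCone 1) ≤ σ'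
    · refine ⟨1, h1, fun t ht => ?_⟩
      rcases t.eq_zero_or_one_or_neg_one with rfl | rfl | rfl
      · rw [signCone_zero]; exact bot_le
      · exact le_rfl
      · exfalso
        have e1 : axisMap n 1 ∈ σ' :=
          h1 (axisMap_mem_prodCone.2 ((mem_signCone_one _).2 zero_le_one))
        have e2 : axisMap n (-1) ∈ σ' :=
          ht (axisMap_mem_prodCone.2 ((mem_signCone_neg_one _).2 (by norm_num)))
        rw [map_neg] at e2
        exact h.salient σ' hσ' _ e1 (fun h0 => by simpa using congrFun h0 0) e2
    · by_cases h2 : prodCone ⊥ (signCone (-1)) ≤ σ'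
      · refine ⟨-1, h2, fun t ht => ?_⟩
        rcases t.eq_zero_or_one_or_neg_one with rfl | rfl | rfl
        · rw [signCone_zero]; exact bot_le
        · exact absurd ht h1
        · exact le_rfl
      · refine ⟨0, ?_, fun t ht => ?_⟩
        · rw [signCone_zero, prodCone_bot_bot]; exact bot_le
        · rcases t.eq_zero_or_one_or_neg_one with rfl | rfl | rfl
          · exact le_rfl
          · exact absurd ht h1
          · exact absurd ht h2
  obtain ⟨s, hs, hmax⟩ := hex
  have heq : σ' = prodCone (σ'.comap (consMap n)) (signCone s) := by
    refine le_antisymm ?_ fun x hx => ?_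
    · conv_lhs => rw [h.eq_sSup_rays hσ']
      refine sSup_le fun ρ hρ => ?_
      rcases hR hρ.1 with ⟨ρ', -, rfl⟩ | h1 | h1
      · refine prodCone_mono (fun u hu => ?_) bot_le
        exact hρ.2.le (consMap_mem_prodCone.2 hu)
      · rw [h1]
        exact prodCone_mono bot_le (hmax 1 (h1 ▸ hρ.2.le))
      · rw [Set.mem_singleton_iff.1 h1]
        exact prodCone_mono bot_le (hmax (-1) ((Set.mem_singleton_iff.1 h1) ▸ hρ.2.le))
    · rw [← consMap_add_axisMap x]
      exact add_mem hx.1 (hs (axisMap_mem_prodCone.2 hx.2))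
  refine ⟨_, ?_, s, heq⟩
  refine h.face_mem σ' hσ' _ ?_
  conv_rhs => rw [heq]
  exact prodCone_isFaceOf (.refl _) (bot_isFaceOf_signCone s)

theorem suspension_mono {Δ Γ : Set (PointedCone ℝ (Fin n → ℝ))} (h : Δ ⊆ Γ) :
    suspension Δ ⊆ suspension Γ := fun _ ⟨σ, hσ, s, hs⟩ => ⟨σ, h hσ, s, hs⟩

/-- A fan Γ that enlarges the suspension of Δ has an equator that enlarges Δ, hence equals it, and Γ
lies in the suspension of its equator. -/
theorem IsMaximalFan.suspension {Δ R : Set (PointedCone ℝ (Fin n → ℝ))}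
    (h : IsMaximalFan R Δ) : IsMaximalFan (suspensionRays R) (suspension Δ) := by
  refine ⟨⟨h.1.1.suspension, fanRays_suspension_subset h.1.1 h.1.2⟩, fun Γ hΓ hle => ?_⟩
  refine (subset_suspension_equator hΓ.1 hΓ.2).trans (suspension_mono ?_)
  refine h.2 ⟨hΓ.1.equator, fanRays_equator_subset hΓ.2⟩ fun σ hσ => ?_
  rw [← equator_suspension (Δ := Δ)] at hσ
  exact hle hσ

theorem isCompleteFan_suspension_iff {Δ : Set (PointedCone ℝ (Fin n → ℝ))} :
    IsCompleteFan (suspension Δ) ↔ IsCompleteFan Δ := by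
  constructor
  · intro h u
    obtain ⟨_, ⟨σ, hσ, s, rfl⟩, hu⟩ := h (consMap n u)
    exact ⟨σ, hσ, consMap_mem_prodCone.1 hu⟩
  · intro h x
    obtain ⟨σ, hσ, hx⟩ := h (tailMap n x)
    rcases le_total 0 (x 0) with h0 | h0
    · exact ⟨_, ⟨σ, hσ, 1, rfl⟩, hx, (mem_signCone_one _).2 h0⟩
    · exact ⟨_, ⟨σ, hσ, -1, rfl⟩, hx, (mem_signCone_neg_one _).2 h0⟩

theorem isSimplicial_prodCone_signCone {σ : PointedCone ℝ (Fin n → ℝ)} (h : σ.IsSimplicial)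
    (s : SignType) : (prodCone σ (signCone s)).IsSimplicial := by
  obtain ⟨B, hfin, hli, rfl⟩ := h
  have hli' : LinearIndepOn ℝ id (consMap n '' B) := by
    refine LinearIndepOn.id_image ?_
    exact hli.map_injOn (consMap n) consMap_injective.injOn
  have h0 : prodCone (hull ℝ B) ⊥ = hull ℝ (consMap n '' B) := by
    rw [← signCone_zero, signCone, prodCone_hull]
    refine le_antisymm (Submodule.span_le.2 ?_) (Submodule.span_mono Set.subset_union_left)
    rintro _ (h | ⟨_, rfl, rfl⟩)
    · exact subset_hull h
    · simp
  by_cases hs : s = 0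
  · subst hs
    rw [signCone_zero]
    exact ⟨_, hfin.image _, hli', h0.symm⟩
  · refine ⟨insert (axisMap n s) (consMap n '' B), (hfin.image _).insert _, ?_, ?_⟩
    · refine hli'.id_insert fun hmem => ?_
      have hle : Submodule.span ℝ (consMap n '' B) ≤ LinearMap.ker (LinearMap.proj 0) := by
        rw [Submodule.span_le]
        rintro _ ⟨u, -, rfl⟩
        simp
      have := hle hmem
      rw [LinearMap.mem_ker, LinearMap.proj_apply, axisMap_zero] at this
      rcases s.eq_zero_or_one_or_neg_one with rfl | rfl | rfl <;> simp at hs this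
    · rw [signCone, prodCone_hull]
      simp [Set.union_comm]

theorem isSimplicial_of_prodCone_bot {σ : PointedCone ℝ (Fin n → ℝ)}
    (h : (prodCone σ ⊥).IsSimplicial) : σ.IsSimplicial := by
  obtain ⟨B, hfin, hli, hB⟩ := h
  have hB0 : ∀ x ∈ B, consMap n (tailMap n x) = x := by
    intro x hx
    have : x ∈ prodCone σ ⊥ := hB ▸ subset_hull hx
    have h0 : x 0 = 0 := this.2
    conv_rhs => rw [← consMap_add_axisMap x, h0]
    simp
  refine ⟨tailMap n '' B, hfin.image _, ?_, ?_⟩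
  · refine LinearIndepOn.id_image (LinearIndepOn.of_comp (consMap n) ?_)
    exact hli.congr fun x hx => (hB0 x hx).symm
  · have h1 : σ = (prodCone σ ⊥).map (tailMap n) := by
      rw [prodCone_bot_eq_map, map_map]
      have : tailMap n ∘ₗ consMap n = LinearMap.id := by ext; simp
      rw [this, map_id]
    rw [h1, ← hB, PointedCone.map, Submodule.map_span]
    rfl

theorem isSimplicialFan_suspension_iff {Δ : Set (PointedCone ℝ (Fin n → ℝ))} :
    IsSimplicialFan (suspension Δ) ↔ IsSimplicialFan Δ := by
  constructor
  · intro h σ hσ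
    exact isSimplicial_of_prodCone_bot (h _ ⟨σ, hσ, 0, by rw [signCone_zero]⟩)
  · rintro h _ ⟨σ, hσ, s, rfl⟩
    exact isSimplicial_prodCone_signCone (h σ hσ) s

theorem HasStrictSupport.mono {Δ Γ : Set (PointedCone ℝ (Fin n → ℝ))} (h : HasStrictSupport Γ)
    (hle : Δ ⊆ Γ) : HasStrictSupport Δ := by
  obtain ⟨m, hm⟩ := h
  exact ⟨m, fun σ hσ τ hτ => hm σ (hle hσ) τ (hle hτ)⟩

/-- The value at `s` of the support function of the fan of the projective line. -/
def signSlope (s : SignType) : ℚ := (1 - (s : ℚ)) / 2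

/-- The fan of the projective line is the normal fan of [0, 1]: the end points 0 and 1 serve the
positive and the negative ray. The origin receives the interior point 1/2, which is minimal only at
x = 0, as strictness demands. -/
theorem signSlope_spec (s t : SignType) {x : ℝ} (hx : x ∈ signCone s) :
    (signSlope s : ℝ) * x ≤ signSlope t * x ∧
      ((signSlope t : ℝ) * x ≤ signSlope s * x → x ∈ signCone t) := by
  rcases s.eq_zero_or_one_or_neg_one with rfl | rfl | rfl <;>
  rcases t.eq_zero_or_one_or_neg_one with rfl | rfl | rfl <;>
  simp only [mem_signCone_zero, mem_signCone_one, mem_signCone_neg_one] at hx ⊢ <;>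
  norm_num [signSlope] <;>
  first
    | done
    | linarith
    | (constructor <;> intros <;> linarith)

/-- In terms of polytopes this is the product with [0, 1]. Both summands satisfy the inequality
separately, so equality of the sums forces equality in each. -/
theorem HasStrictSupport.suspension {Δ : Set (PointedCone ℝ (Fin n → ℝ))}
    (h : HasStrictSupport Δ) : HasStrictSupport (suspension Δ) := by
  classical
  obtain ⟨m, hm⟩ := h
  have hch : ∀ σ' : PointedCone ℝ (Fin (n + 1) → ℝ), ∃ p : PointedCone ℝ (Fin n → ℝ) × SignType,
      σ' ∈ _root_.suspension Δ → p.1 ∈ Δ ∧ σ' = prodCone p.1 (signCone p.2) := by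
    intro σ'
    by_cases hσ' : σ' ∈ _root_.suspension Δ
    · obtain ⟨σ, hσ, s, h⟩ := hσ'
      exact ⟨(σ, s), fun _ => ⟨hσ, h⟩⟩
    · exact ⟨(⊥, 0), fun h => absurd h hσ'⟩
  choose p hp using hch
  refine ⟨fun σ' => Fin.cons (signSlope (p σ').2) (m (p σ').1), fun σ' hσ' τ' hτ' x hx => ?_⟩
  have hdot : ∀ (z : ℚ) (q : Fin n → ℚ), ratVec (Fin.cons z q : Fin (n + 1) → ℚ) ⬝ᵥ x =
      (z : ℝ) * x 0 + ratVec q ⬝ᵥ tailMap n x := by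
    intro z q
    simp [dotProduct, Fin.sum_univ_succ, ratVec]
  rw [hdot, hdot]
  obtain ⟨hσ, hσe⟩ := hp σ' hσ'
  obtain ⟨hτ, hτe⟩ := hp τ' hτ'
  rw [hσe] at hx
  obtain ⟨h1, h2⟩ := hm _ hσ _ hτ (tailMap n x) hx.1
  obtain ⟨h3, h4⟩ := signSlope_spec (p σ').2 (p τ').2 (x := x 0) hx.2
  refine ⟨by linarith, fun hle => ?_⟩
  rw [hτe]
  exact ⟨h2 (by linarith), h4 (by linarith)⟩

theorem isRationalRay_suspensionRays {R : Set (PointedCone ℝ (Fin n → ℝ))}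
    (h : ∀ ρ ∈ R, IsRationalRay ρ) : ∀ ρ ∈ suspensionRays R, IsRationalRay ρ := by
  have haxis : ∀ s : SignType, s ≠ 0 → IsRationalRay (prodCone (n := n) ⊥ (signCone s)) := by
    intro s hs
    refine ⟨Fin.cons (s : ℤ) 0, fun h => hs ?_, ?_⟩
    · have := congrFun h 0
      rcases s.eq_zero_or_one_or_neg_one with rfl | rfl | rfl <;> simp at hs this
    · have h0 : latticeVec (0 : Fin n → ℤ) = 0 := by ext; simp [latticeVec]
      have hb : (⊥ : PointedCone ℝ (Fin n → ℝ)) = hull ℝ ∅ := Submodule.span_empty.symm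
      rw [latticeVec_cons, h0, hb, signCone, prodCone_hull]
      simp
  rintro _ (⟨ρ, hρ, rfl⟩ | rfl | rfl)
  · obtain ⟨v, hv, rfl⟩ := h ρ hρ
    refine ⟨Fin.cons 0 v, fun h => hv ?_, ?_⟩
    · ext i
      simpa using congrFun h i.succ
    · have hb : (⊥ : PointedCone ℝ ℝ) = hull ℝ ∅ := Submodule.span_empty.symm
      simp only [latticeVec_cons]
      rw [hb, prodCone_hull]
      simp
  · exact haxis 1 (by simp)
  · exact haxis (-1) (by simp)

theorem sSup_suspensionRays {R : Set (PointedCone ℝ (Fin n → ℝ))} (h : sSup R = ⊤) :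
    sSup (suspensionRays R) = ⊤ := by
  rw [eq_top_iff]
  intro x _
  rw [← consMap_add_axisMap x]
  refine add_mem ?_ ?_
  · have : sSup R ≤ (sSup (suspensionRays R)).comap (consMap n) := by
      refine sSup_le fun ρ hρ u hu => ?_
      exact (le_sSup (Or.inl ⟨ρ, hρ, rfl⟩) : prodCone ρ ⊥ ≤ _) (consMap_mem_prodCone.2 hu)
    exact this (h ▸ Submodule.mem_top)
  · rcases le_total 0 (x 0) with h0 | h0
    · exact (le_sSup (Or.inr (Or.inl rfl)) : prodCone ⊥ (signCone 1) ≤ _)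
        (axisMap_mem_prodCone.2 ((mem_signCone_one _).2 h0))
    · exact (le_sSup (Or.inr (Or.inr rfl)) : prodCone ⊥ (signCone (-1)) ≤ _)
        (axisMap_mem_prodCone.2 ((mem_signCone_neg_one _).2 h0))

/-- The properties of a set of rays in the theorem, with projectivity expressed through support
functions. -/
structure IsGoodRaySet (R : Set (PointedCone ℝ (Fin n → ℝ))) : Prop where
  finite : R.Finite
  rational : ∀ ρ ∈ R, IsRationalRay ρ
  sSup_eq_top : sSup R = ⊤
  support : ∀ Δ, IsFan Δ → fanRays Δ ⊆ R → IsCompleteFan Δ → HasStrictSupport Δ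
  complete_simplicial : ∃ Δ, IsMaximalFan R Δ ∧ IsCompleteFan Δ ∧ IsSimplicialFan Δ
  complete_not_simplicial : ∃ Δ, IsMaximalFan R Δ ∧ IsCompleteFan Δ ∧ ¬ IsSimplicialFan Δ
  not_complete_simplicial : ∃ Δ, IsMaximalFan R Δ ∧ ¬ IsCompleteFan Δ ∧ IsSimplicialFan Δ
  not_complete_not_simplicial : ∃ Δ, IsMaximalFan R Δ ∧ ¬ IsCompleteFan Δ ∧ ¬ IsSimplicialFan Δ

theorem IsGoodRaySet.suspension {R : Set (PointedCone ℝ (Fin n → ℝ))} (h : IsGoodRaySet R) :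
    IsGoodRaySet (suspensionRays R) where
  finite := (h.finite.image _).union (Set.toFinite _)
  rational := isRationalRay_suspensionRays h.rational
  sSup_eq_top := sSup_suspensionRays h.sSup_eq_top
  support := by
    intro Δ hΔ hR hc
    have hsub := subset_suspension_equator hΔ hR
    -- A complete fan over the suspended rays need not be assumed to be a suspension: it lies in the
    -- suspension of its equator, and that equator is complete.
    refine HasStrictSupport.mono (HasStrictSupport.suspension ?_) hsub
    refine h.support _ hΔ.equator (fanRays_equator_subset hR) ?_
    rw [← isCompleteFan_suspension_iff]
    intro x
    obtain ⟨σ, hσ, hx⟩ := hc x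
    exact ⟨σ, hsub hσ, hx⟩
  complete_simplicial := by
    obtain ⟨Δ, h1, h2, h3⟩ := h.complete_simplicial
    exact ⟨_, h1.suspension, isCompleteFan_suspension_iff.2 h2,
      isSimplicialFan_suspension_iff.2 h3⟩
  complete_not_simplicial := by
    obtain ⟨Δ, h1, h2, h3⟩ := h.complete_not_simplicial
    exact ⟨_, h1.suspension, isCompleteFan_suspension_iff.2 h2,
      isSimplicialFan_suspension_iff.not.2 h3⟩
  not_complete_simplicial := by
    obtain ⟨Δ, h1, h2, h3⟩ := h.not_complete_simplicial
    exact ⟨_, h1.suspension, isCompleteFan_suspension_iff.not.2 h2,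
      isSimplicialFan_suspension_iff.2 h3⟩
  not_complete_not_simplicial := by
    obtain ⟨Δ, h1, h2, h3⟩ := h.not_complete_not_simplicial
    exact ⟨_, h1.suspension, isCompleteFan_suspension_iff.not.2 h2,
      isSimplicialFan_suspension_iff.not.2 h3⟩

theorem IsGoodRaySet.conclusion {R : Set (PointedCone ℝ (Fin n → ℝ))} (h : IsGoodRaySet R) :
    R.Finite ∧ (∀ ρ ∈ R, IsRationalRay ρ) ∧ sSup R = ⊤ ∧
      (∀ Δ, IsMaximalFan R Δ → IsProjectiveFan Δ ∨ ¬ IsCompleteFan Δ) ∧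
      (∃ Δ, IsMaximalFan R Δ ∧ IsProjectiveFan Δ ∧ IsSimplicialFan Δ) ∧
      (∃ Δ, IsMaximalFan R Δ ∧ IsProjectiveFan Δ ∧ ¬ IsSimplicialFan Δ) ∧
      (∃ Δ, IsMaximalFan R Δ ∧ ¬ IsProjectiveFan Δ ∧ ¬ IsCompleteFan Δ ∧ IsSimplicialFan Δ) ∧
      (∃ Δ, IsMaximalFan R Δ ∧ ¬ IsProjectiveFan Δ ∧ ¬ IsCompleteFan Δ ∧ ¬ IsSimplicialFan Δ) := by
  have hproj : ∀ Δ, IsMaximalFan R Δ → IsCompleteFan Δ → IsProjectiveFan Δ := fun Δ hΔ hc =>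
    (h.support Δ hΔ.1.1 hΔ.1.2 hc).isProjectiveFan hΔ.1.1 hc
  refine ⟨h.finite, h.rational, h.sSup_eq_top, fun Δ hΔ => ?_, ?_, ?_, ?_, ?_⟩
  · by_cases hc : IsCompleteFan Δ
    · exact Or.inl (hproj Δ hΔ hc)
    · exact Or.inr hc
  · obtain ⟨Δ, h1, h2, h3⟩ := h.complete_simplicial
    exact ⟨Δ, h1, hproj Δ h1 h2, h3⟩
  · obtain ⟨Δ, h1, h2, h3⟩ := h.complete_not_simplicial
    exact ⟨Δ, h1, hproj Δ h1 h2, h3⟩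
  · obtain ⟨Δ, h1, h2, h3⟩ := h.not_complete_simplicial
    exact ⟨Δ, h1, fun hp => h2 hp.isCompleteFan, h2, h3⟩
  · obtain ⟨Δ, h1, h2, h3⟩ := h.not_complete_not_simplicial
    exact ⟨Δ, h1, fun hp => h2 hp.isCompleteFan, h2, h3⟩

end Suspension

/-! ### The seven generators, their sign data, and the combinatorial search. -/

section Generators

open PointedCone

/-- The generators of the seven rays in `ℝ⁴`. -/
def gen : Fin 7 → Fin 4 → ℤ :=
  ![![-2, -3, -1, -1], ![0, -1, -1, 0], ![1, 0, 0, 0], ![0, 1, 0, 0], ![0, 0, 1, 0],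
    ![0, 0, 0, 1], ![-1, -2, -1, -1]]

/-- The seven generators as real vectors. -/
def genVec (i : Fin 7) : Fin 4 → ℝ := latticeVec (gen i)

/-- The ray spanned by a generator. -/
def genRay (i : Fin 7) : PointedCone ℝ (Fin 4 → ℝ) := hull ℝ {genVec i}

/-- The value of an integral functional on a generator. -/
def pairing (h : Fin 4 → ℤ) (i : Fin 7) : ℤ :=
  h 0 * gen i 0 + h 1 * gen i 1 + h 2 * gen i 2 + h 3 * gen i 3

/-- The bit masks of the sets of indices at which `f` is positive and negative. -/
def signMasks (f : Fin 7 → ℤ) : ℕ × ℕ :=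
  (Nat.ofBits fun i => decide (0 < f i), Nat.ofBits fun i => decide (f i < 0))

/-- Inclusion of bit masks. -/
def subMask (a b : ℕ) : Bool := Nat.beq (a &&& b) a

/-- Disjointness of bit masks. -/
def disjMask (a b : ℕ) : Bool := Nat.beq (a &&& b) 0

/-- Integral normal vectors of the hyperplanes spanned by the generators, with both signs. -/
def walls : List (Fin 4 → ℤ) :=
  [![-3, 2, 0, 0], ![-2, 1, 0, 0], ![-1, 0, 0, 0], ![-1, 0, 0, 1], ![-1, 0, 0, 2],
   ![-1, 0, 1, 0], ![-1, 0, 2, 0], ![-1, 1, -1, 0], ![-1, 1, 0, -1], ![0, -1, 0, 0],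
   ![0, -1, 0, 2], ![0, -1, 0, 3], ![0, -1, 1, 0], ![0, -1, 1, 1], ![0, -1, 1, 2],
   ![0, -1, 2, 0], ![0, -1, 3, 0], ![0, 0, -1, 0], ![0, 0, -1, 1], ![0, 0, 0, -1], ![0, 0, 0, 1],
   ![0, 0, 1, -1], ![0, 0, 1, 0], ![0, 1, -3, 0], ![0, 1, -2, 0], ![0, 1, -1, -2],
   ![0, 1, -1, -1], ![0, 1, -1, 0], ![0, 1, 0, -3], ![0, 1, 0, -2], ![0, 1, 0, 0],
   ![1, -1, 0, 1], ![1, -1, 1, 0], ![1, 0, -2, 0], ![1, 0, -1, 0], ![1, 0, 0, -2],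
   ![1, 0, 0, -1], ![1, 0, 0, 0], ![2, -1, 0, 0], ![3, -2, 0, 0]]

/-- The sign masks of `walls`. -/
def wallMasks : List (ℕ × ℕ) :=
  [(8, 70), (9, 6), (65, 4), (33, 4), (32, 68), (17, 6), (16, 70), (8, 20), (8, 38), (67, 8),
   (35, 8), (34, 72), (81, 8), (49, 8), (48, 72), (17, 10), (16, 74), (67, 16), (34, 16),
   (65, 32), (32, 65), (16, 34), (16, 67), (74, 16), (10, 17), (72, 48), (8, 49), (8, 81),
   (72, 34), (8, 35), (8, 67), (38, 8), (20, 8), (70, 16), (6, 17), (68, 32), (4, 33), (4, 65),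
   (6, 9), (70, 8)]

/-- The linear dependencies of minimal support between the generators, with both signs. -/
def dependencies : List (Fin 7 → ℤ) :=
  [![0, 0, -1, -2, -1, -1, -1], ![0, 0, 1, 2, 1, 1, 1], ![0, 1, 0, 1, 1, 0, 0],
   ![0, -1, 0, -1, -1, 0, 0], ![-1, 0, 0, 1, 1, 1, 2], ![1, 0, 0, -1, -1, -1, -2],
   ![0, 2, -1, 0, 1, -1, -1], ![0, -2, 1, 0, -1, 1, 1], ![-2, 0, -1, 0, 1, 1, 3],
   ![2, 0, 1, 0, -1, -1, -3], ![1, 1, 0, 0, 0, -1, -2], ![-1, -1, 0, 0, 0, 1, 2],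
   ![0, 1, -1, -1, 0, -1, -1], ![0, -1, 1, 1, 0, 1, 1], ![-1, 0, -1, -1, 0, 0, 1],
   ![1, 0, 1, 1, 0, 0, -1], ![-1, 1, -1, 0, 1, 0, 1], ![1, -1, 1, 0, -1, 0, -1],
   ![-1, 0, -2, -3, -1, -1, 0], ![1, 0, 2, 3, 1, 1, 0], ![-1, 3, -2, 0, 2, -1, 0],
   ![1, -3, 2, 0, -2, 1, 0], ![-1, 1, -2, -2, 0, -1, 0], ![1, -1, 2, 2, 0, 1, 0]]

/-- The sign masks of `dependencies`. -/
def circuitMasks : List (ℕ × ℕ) :=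
  [(0, 124), (124, 0), (26, 0), (0, 26), (120, 1), (1, 120), (18, 100), (100, 18), (112, 5),
   (5, 112), (3, 96), (96, 3), (2, 108), (108, 2), (64, 13), (13, 64), (82, 5), (5, 82), (0, 61),
   (61, 0), (18, 37), (37, 18), (2, 45), (45, 2)]

/-- Vectors `x`, each with some of the walls that are negative on `x`. -/
def tests : List ((Fin 4 → ℤ) × List (Fin 4 → ℤ)) :=
  [(![-2, -2, 2, 1],
     [![0, 0, -1, 0], ![0, 0, 0, -1], ![1, 0, 0, 0], ![3, -2, 0, 0]]),
   (![4, 1, -2, -1],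
     [![-1, 0, 0, 0], ![0, -1, 0, 0], ![0, 0, 0, 1], ![0, 0, 1, -1]]),
   (![1, 1, -1, 3],
     [![-1, 0, 0, 0], ![0, -1, 0, 0], ![0, 0, 0, -1], ![0, 0, 1, 0]]),
   (![-3, 1, 2, -2],
     [![-1, 0, 0, 2], ![0, -1, 0, 0], ![0, 0, -1, 0], ![0, 0, 0, 1], ![1, 0, 0, -1]]),
   (![-5, -1, -3, -1],
     [![-1, 0, 2, 0], ![0, -1, 0, 2], ![0, 0, 0, 1], ![1, 0, -1, 0], ![1, 0, 0, -2]]),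
   (![-7, -13, -1, -4],
     [![-1, 0, 0, 2], ![0, 0, -1, 1], ![0, 0, 0, 1], ![0, 1, 0, -3], ![1, 0, 0, -1],
      ![2, -1, 0, 0]]),
   (![-5, -11, -2, -4],
     [![-2, 1, 0, 0], ![-1, 0, 0, 2], ![0, -1, 0, 3], ![0, 0, -1, 1], ![0, 0, 0, 1],
      ![1, 0, 0, -1]]),
   (![4, -4, 1, -1],
     [![-1, 0, 0, 0], ![0, 0, -1, 0], ![0, 0, 0, 1], ![0, 1, 0, -3]]),
   (![1, -3, -2, 3],
     [![-1, 0, 0, 0], ![0, -1, 2, 0], ![0, 0, 0, -1], ![0, 0, 1, 0], ![0, 1, -1, 0]])]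

/-- The sets of generators on which the walls in `tests` are negative. -/
def testMasks : List (List ℕ) :=
  [[16, 32, 65, 8], [4, 8, 65, 34], [4, 8, 32, 67], [68, 8, 16, 65, 33], [70, 8, 65, 17, 32],
   [68, 16, 65, 34, 33, 9], [6, 68, 72, 16, 65, 33], [4, 16, 65, 34], [4, 10, 32, 67, 81]]

/-- Rational polytopes, given by the values `-p` of their support function on the generators and by
vertices `m`, each with the mask of generators at which the vertex is not extremal. -/
def certificates : List ((ℤ × ℤ × ℤ) × List (ℕ × (Fin 4 → ℤ))) :=
  [((6, 2, 7),
     [(67, ![0, 0, 0, 0]), (70, ![3, 0, 0, 0]), (72, ![0, 2, 0, 0]), (81, ![0, 0, 2, 0]),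
      (84, ![2, 0, 2, 0]), (98, ![0, 0, 0, 6]), (112, ![0, 0, 2, 4])]),
   ((8, 2, 9),
     [(67, ![0, 0, 0, 0]), (70, ![4, 0, 0, 0]), (73, ![0, 2, 0, 0]), (76, ![1, 2, 0, 0]),
      (81, ![0, 0, 2, 0]), (84, ![3, 0, 2, 0]), (98, ![0, 0, 0, 8]), (104, ![0, 2, 0, 2]),
      (112, ![0, 0, 2, 6])]),
   ((6, 4, 7),
     [(67, ![0, 0, 0, 0]), (70, ![3, 0, 0, 0]), (74, ![0, 2, 0, 0]), (81, ![0, 0, 4, 0]),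
      (84, ![1, 0, 4, 0]), (88, ![0, 1, 3, 0]), (98, ![0, 0, 0, 6]), (112, ![0, 0, 4, 2])]),
   ((6, 2, 4),
     [(8, ![0, 2, 0, 0]), (20, ![2, 0, 2, 0]), (35, ![0, 0, 0, 4]), (38, ![2, 0, 0, 2]),
      (49, ![0, 0, 2, 2]), (67, ![0, 0, 0, 0]), (70, ![3, 0, 0, 0]), (81, ![0, 0, 2, 0])]),
   ((10, 3, 6),
     [(9, ![0, 3, 0, 0]), (14, ![2, 2, 0, 0]), (21, ![3, 0, 3, 0]), (22, ![4, 0, 2, 0]),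
      (35, ![0, 0, 0, 6]), (38, ![4, 0, 0, 2]), (49, ![0, 0, 3, 3]), (67, ![0, 0, 0, 0]),
      (70, ![5, 0, 0, 0]), (81, ![0, 0, 3, 0])]),
   ((6, 3, 4),
     [(10, ![0, 2, 0, 0]), (21, ![1, 0, 3, 0]), (22, ![2, 0, 2, 0]), (25, ![0, 1, 2, 0]),
      (35, ![0, 0, 0, 4]), (38, ![2, 0, 0, 2]), (49, ![0, 0, 3, 1]), (67, ![0, 0, 0, 0]),
      (70, ![3, 0, 0, 0]), (81, ![0, 0, 3, 0])]),
   ((10, 4, 6),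
     [(11, ![0, 3, 0, 0]), (14, ![2, 2, 0, 0]), (21, ![2, 0, 4, 0]), (22, ![4, 0, 2, 0]),
      (25, ![0, 2, 2, 0]), (35, ![0, 0, 0, 6]), (38, ![4, 0, 0, 2]), (49, ![0, 0, 4, 2]),
      (67, ![0, 0, 0, 0]), (70, ![5, 0, 0, 0]), (81, ![0, 0, 4, 0])]),
   ((8, 2, 5),
     [(12, ![1, 2, 0, 0]), (20, ![3, 0, 2, 0]), (35, ![0, 0, 0, 5]), (38, ![3, 0, 0, 2]),
      (41, ![0, 2, 0, 1]), (49, ![0, 0, 2, 3]), (67, ![0, 0, 0, 0]), (70, ![4, 0, 0, 0]),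
      (73, ![0, 2, 0, 0]), (81, ![0, 0, 2, 0])]),
   ((12, 3, 7),
     [(13, ![1, 3, 0, 0]), (14, ![3, 2, 0, 0]), (21, ![4, 0, 3, 0]), (22, ![5, 0, 2, 0]),
      (35, ![0, 0, 0, 7]), (38, ![5, 0, 0, 2]), (41, ![0, 3, 0, 1]), (49, ![0, 0, 3, 4]),
      (67, ![0, 0, 0, 0]), (70, ![6, 0, 0, 0]), (73, ![0, 3, 0, 0]), (81, ![0, 0, 3, 0])]),
   ((8, 2, 6),
     [(35, ![0, 0, 0, 6]), (38, ![2, 0, 0, 4]), (40, ![0, 2, 0, 2]), (49, ![0, 0, 2, 4]),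
      (52, ![2, 0, 2, 2]), (67, ![0, 0, 0, 0]), (70, ![4, 0, 0, 0]), (73, ![0, 2, 0, 0]),
      (76, ![1, 2, 0, 0]), (81, ![0, 0, 2, 0]), (84, ![3, 0, 2, 0])]),
   ((10, 2, 7),
     [(35, ![0, 0, 0, 7]), (38, ![3, 0, 0, 4]), (41, ![0, 2, 0, 3]), (44, ![1, 2, 0, 2]),
      (49, ![0, 0, 2, 5]), (52, ![3, 0, 2, 2]), (67, ![0, 0, 0, 0]), (70, ![5, 0, 0, 0]),
      (73, ![0, 2, 0, 0]), (76, ![2, 2, 0, 0]), (81, ![0, 0, 2, 0]), (84, ![4, 0, 2, 0])]),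
   ((12, 6, 10),
     [(35, ![0, 0, 0, 10]), (38, ![2, 0, 0, 8]), (42, ![0, 2, 0, 6]), (49, ![0, 0, 6, 4]),
      (52, ![2, 0, 6, 2]), (56, ![0, 2, 4, 2]), (67, ![0, 0, 0, 0]), (70, ![6, 0, 0, 0]),
      (74, ![0, 4, 0, 0]), (81, ![0, 0, 6, 0]), (84, ![3, 0, 6, 0]), (88, ![0, 3, 3, 0])]),
   ((6, 4, 5),
     [(20, ![1, 0, 4, 0]), (24, ![0, 1, 3, 0]), (35, ![0, 0, 0, 5]), (38, ![1, 0, 0, 4]),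
      (42, ![0, 1, 0, 3]), (49, ![0, 0, 4, 1]), (67, ![0, 0, 0, 0]), (70, ![3, 0, 0, 0]),
      (74, ![0, 2, 0, 0]), (81, ![0, 0, 4, 0])]),
   ((12, 7, 9),
     [(21, ![2, 0, 7, 0]), (22, ![3, 0, 6, 0]), (25, ![0, 2, 5, 0]), (26, ![0, 3, 3, 0]),
      (35, ![0, 0, 0, 9]), (38, ![3, 0, 0, 6]), (42, ![0, 3, 0, 3]), (49, ![0, 0, 7, 2]),
      (67, ![0, 0, 0, 0]), (70, ![6, 0, 0, 0]), (74, ![0, 4, 0, 0]), (81, ![0, 0, 7, 0])]),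
   ((6, 2, 5),
     [(35, ![0, 0, 0, 5]), (38, ![1, 0, 0, 4]), (42, ![0, 1, 0, 3]), (49, ![0, 0, 2, 3]),
      (52, ![1, 0, 2, 2]), (56, ![0, 1, 1, 2]), (67, ![0, 0, 0, 0]), (70, ![3, 0, 0, 0]),
      (72, ![0, 2, 0, 0]), (81, ![0, 0, 2, 0]), (84, ![2, 0, 2, 0])]),
   ((8, 2, 7),
     [(35, ![0, 0, 0, 7]), (38, ![1, 0, 0, 6]), (42, ![0, 1, 0, 5]), (49, ![0, 0, 2, 5]),
      (52, ![1, 0, 2, 4]), (56, ![0, 1, 1, 4]), (67, ![0, 0, 0, 0]), (70, ![4, 0, 0, 0]),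
      (73, ![0, 2, 0, 0]), (76, ![1, 2, 0, 0]), (81, ![0, 0, 2, 0]), (84, ![3, 0, 2, 0]),
      (104, ![0, 2, 0, 2])]),
   ((6, 7, 7),
     [(67, ![0, 0, 0, 0]), (70, ![3, 0, 0, 0]), (74, ![0, 2, 0, 0]), (82, ![0, 0, 6, 0]),
      (98, ![0, 0, 0, 6])]),
   ((6, 5, 4),
     [(10, ![0, 2, 0, 0]), (19, ![0, 0, 4, 0]), (22, ![2, 0, 2, 0]), (35, ![0, 0, 0, 4]),
      (38, ![2, 0, 0, 2]), (67, ![0, 0, 0, 0]), (70, ![3, 0, 0, 0])]),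
   ((10, 7, 6),
     [(11, ![0, 3, 0, 0]), (14, ![2, 2, 0, 0]), (19, ![0, 0, 6, 0]), (22, ![4, 0, 2, 0]),
      (35, ![0, 0, 0, 6]), (38, ![4, 0, 0, 2]), (67, ![0, 0, 0, 0]), (70, ![5, 0, 0, 0])]),
   ((6, 6, 5),
     [(19, ![0, 0, 5, 0]), (22, ![1, 0, 4, 0]), (26, ![0, 1, 3, 0]), (35, ![0, 0, 0, 5]),
      (38, ![1, 0, 0, 4]), (42, ![0, 1, 0, 3]), (67, ![0, 0, 0, 0]), (70, ![3, 0, 0, 0]),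
      (74, ![0, 2, 0, 0])]),
   ((7, 1, 3),
     [(7, ![3, 0, 0, 0]), (13, ![1, 1, 0, 0]), (21, ![2, 0, 1, 0]), (35, ![0, 0, 0, 3]),
      (41, ![0, 1, 0, 1]), (49, ![0, 0, 1, 2]), (67, ![0, 0, 0, 0]), (73, ![0, 1, 0, 0]),
      (81, ![0, 0, 1, 0])]),
   ((5, 1, 2),
     [(7, ![2, 0, 0, 0]), (9, ![0, 1, 0, 0]), (21, ![1, 0, 1, 0]), (35, ![0, 0, 0, 2]),
      (49, ![0, 0, 1, 1]), (67, ![0, 0, 0, 0]), (81, ![0, 0, 1, 0])]),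
   ((9, 3, 4),
     [(7, ![4, 0, 0, 0]), (11, ![0, 2, 0, 0]), (21, ![1, 0, 3, 0]), (25, ![0, 1, 2, 0]),
      (35, ![0, 0, 0, 4]), (49, ![0, 0, 3, 1]), (67, ![0, 0, 0, 0]), (81, ![0, 0, 3, 0])]),
   ((5, 3, 2),
     [(7, ![2, 0, 0, 0]), (11, ![0, 1, 0, 0]), (19, ![0, 0, 2, 0]), (35, ![0, 0, 0, 2]),
      (67, ![0, 0, 0, 0])])]

/-- The masks in `certificates`. -/
def certificateMasks : List (List ℕ) :=
  [[67, 70, 72, 81, 84, 98, 112], [67, 70, 73, 76, 81, 84, 98, 104, 112],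
   [67, 70, 74, 81, 84, 88, 98, 112], [8, 20, 35, 38, 49, 67, 70, 81],
   [9, 14, 21, 22, 35, 38, 49, 67, 70, 81], [10, 21, 22, 25, 35, 38, 49, 67, 70, 81],
   [11, 14, 21, 22, 25, 35, 38, 49, 67, 70, 81], [12, 20, 35, 38, 41, 49, 67, 70, 73, 81],
   [13, 14, 21, 22, 35, 38, 41, 49, 67, 70, 73, 81],
   [35, 38, 40, 49, 52, 67, 70, 73, 76, 81, 84],
   [35, 38, 41, 44, 49, 52, 67, 70, 73, 76, 81, 84],
   [35, 38, 42, 49, 52, 56, 67, 70, 74, 81, 84, 88], [20, 24, 35, 38, 42, 49, 67, 70, 74, 81],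
   [21, 22, 25, 26, 35, 38, 42, 49, 67, 70, 74, 81],
   [35, 38, 42, 49, 52, 56, 67, 70, 72, 81, 84],
   [35, 38, 42, 49, 52, 56, 67, 70, 73, 76, 81, 84, 104], [67, 70, 74, 82, 98],
   [10, 19, 22, 35, 38, 67, 70], [11, 14, 19, 22, 35, 38, 67, 70],
   [19, 22, 26, 35, 38, 42, 67, 70, 74], [7, 13, 21, 35, 41, 49, 67, 73, 81],
   [7, 9, 21, 35, 49, 67, 81], [7, 11, 21, 25, 35, 49, 67, 81], [7, 11, 19, 35, 67]]

theorem subMask_iff {a b : ℕ} :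
    subMask a b = true ↔ ∀ i, a.testBit i = true → b.testBit i = true := by
  rw [subMask, Nat.beq_eq]
  constructor
  · intro h i hi
    rw [← h, Nat.testBit_and] at hi
    simp_all
  · intro h
    refine Nat.eq_of_testBit_eq fun i => ?_
    rw [Nat.testBit_and]
    have := h i
    cases h1 : a.testBit i <;> simp_all

theorem disjMask_iff {a b : ℕ} :
    disjMask a b = true ↔ ∀ i, a.testBit i = true → b.testBit i = false := by
  rw [disjMask, Nat.beq_eq]
  constructor
  · intro h i hi
    have := congrArg (fun k => Nat.testBit k i) h
    simpa [hi] using this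
  · intro h
    refine Nat.eq_of_testBit_eq fun i => ?_
    rw [Nat.testBit_and]
    have := h i
    cases h1 : a.testBit i <;> simp_all

theorem testBit_signMasks_fst (f : Fin 7 → ℤ) (i : Fin 7) :
    (signMasks f).1.testBit i = true ↔ 0 < f i := by
  rw [signMasks, Nat.testBit_ofBits_lt _ _ i.2]
  simp

theorem testBit_signMasks_snd (f : Fin 7 → ℤ) (i : Fin 7) :
    (signMasks f).2.testBit i = true ↔ f i < 0 := by
  rw [signMasks, Nat.testBit_ofBits_lt _ _ i.2]
  simp

theorem lt_of_testBit_signMasks_fst (f : Fin 7 → ℤ) {i : ℕ}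
    (h : (signMasks f).1.testBit i = true) : i < 7 := by
  by_contra hi
  rw [signMasks, Nat.testBit_ofBits_ge _ _ (not_lt.1 hi)] at h
  exact Bool.false_ne_true h

theorem lt_of_testBit_signMasks_snd (f : Fin 7 → ℤ) {i : ℕ}
    (h : (signMasks f).2.testBit i = true) : i < 7 := by
  by_contra hi
  rw [signMasks, Nat.testBit_ofBits_ge _ _ (not_lt.1 hi)] at h
  exact Bool.false_ne_true h

/-- The search runs on literal bit masks; this identity and its analogues tie them to actual
vectors. The lists of walls and dependences need not be exhaustive for the argument, since each
entry is used only as a valid functional or a valid relation. -/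
theorem wallMasks_eq : wallMasks = walls.map fun h => signMasks (pairing h) := by
  decide +kernel

theorem circuitMasks_eq : circuitMasks = dependencies.map signMasks := by
  decide +kernel

theorem sum_dependencies : ∀ y ∈ dependencies, ∀ j, ∑ i, y i * gen i j = 0 := by
  decide +kernel

theorem testMasks_eq :
    testMasks = tests.map fun t => t.2.map fun h => (signMasks (pairing h)).2 := by
  decide +kernel

theorem tests_neg : ∀ t ∈ tests, ∀ h ∈ t.2,
    h 0 * t.1 0 + h 1 * t.1 1 + h 2 * t.1 2 + h 3 * t.1 3 < 0 := by
  decide +kernel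

theorem certificateMasks_eq : certificateMasks = certificates.map fun c => c.2.map Prod.fst := by
  decide +kernel

/-- The values on the generators that are attached to a certificate. -/
def certValue (p : ℤ × ℤ × ℤ) : Fin 7 → ℤ := ![p.1, p.2.1, 0, 0, 0, 0, p.2.2]

/-- `certValue` vanishes on the four coordinate vectors, a normalization by translating the
polytope. Each listed point satisfies all seven inequalities, strictly at exactly the indices in its
mask. -/
theorem certificates_spec : ∀ c ∈ certificates, ∀ v ∈ c.2, ∀ i : Fin 7,
    0 ≤ certValue c.1 i + pairing v.2 i ∧
      (v.1.testBit i = true ↔ 0 < certValue c.1 i + pairing v.2 i) := by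
  decide +kernel

/-- No linear dependence separates the complements of two index sets. -/
def compatible (K L : ℕ) : Bool :=
  circuitMasks.all fun c => !(disjMask K c.2 && disjMask L c.1 && !disjMask (K ||| L) (c.1 ||| c.2))

/-- Some wall functional separates the cones generated by the complements of `K` and `L` in a
common face. -/
def separated (K L : ℕ) : Bool :=
  let W := wallMasks.filter fun w => subMask w.2 K && subMask w.1 L
  subMask L (K ||| (W.map Prod.fst).foldr (· ||| ·) 0) &&
    subMask K (L ||| (W.map Prod.snd).foldr (· ||| ·) 0)

/-- The mask of the complement of a single index. -/
def rayMask (i : ℕ) : ℕ := 127 ^^^ 2 ^ i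

/-- The masks of cones that can belong to a fan with the given rays. -/
def candidates : List ℕ :=
  (List.range 128).filter fun K => compatible K 127 &&
    (List.range 7).all fun i => K.testBit i || compatible K (rayMask i)

/-- `K` is a nonempty union of members of `M`. -/
def covered (M : List ℕ) (K : ℕ) : Bool :=
  !Nat.beq K 0 && Nat.beq ((M.filter fun m => subMask m K).foldr (· ||| ·) 0) K

/-- Case distinction on which cone contains the successive test vectors. -/
def search : List (List ℕ) → List ℕ → Bool
  | [], C => certificateMasks.any fun M => C.all (covered M)
  | T :: Ts, C => (certificateMasks.any fun M => C.all (covered M)) ||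
      (C.filter fun K => T.all fun t => !subMask t K).all fun K => search Ts (C.filter (compatible K))

/-- This is the computational core. Every branch of choices of cones for the test vectors ends with
one polytope accounting for all masks still compatible with the choices made. -/
theorem search_eq_true : search testMasks candidates = true := by
  decide +kernel

/-- F is the unknown set of masks of a complete fan and C a known set containing it. Choosing the
member of F attached to a test vector keeps F inside the filtered C, because members of F are
pairwise compatible. -/
theorem exists_certificate_of_search (F : Set ℕ) (hF : ∀ K ∈ F, ∀ L ∈ F, compatible K L = true)
    (Ts : List (List ℕ)) (hT : ∀ T ∈ Ts, ∃ K ∈ F, ∀ t ∈ T, subMask t K = false) (C : List ℕ)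
    (hC : ∀ K ∈ F, K ∈ C) (h : search Ts C = true) :
    ∃ M ∈ certificateMasks, ∀ K ∈ F, covered M K = true := by
  have hleaf : ∀ C : List ℕ, (∀ K ∈ F, K ∈ C) →
      (certificateMasks.any fun M => C.all (covered M)) = true →
      ∃ M ∈ certificateMasks, ∀ K ∈ F, covered M K = true := by
    intro C hC h
    simp only [List.any_eq_true, List.all_eq_true] at h
    obtain ⟨M, hM, h⟩ := h
    exact ⟨M, hM, fun K hK => h K (hC K hK)⟩
  induction Ts generalizing C with
  | nil => exact hleaf C hC h
  | cons T Ts ih =>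
    rw [search, Bool.or_eq_true] at h
    rcases h with h | h
    · exact hleaf C hC h
    · obtain ⟨K, hK, hKT⟩ := hT T (by simp)
      rw [List.all_eq_true] at h
      refine ih (fun T' hT' => hT T' (by simp [hT'])) _ (fun L hL => ?_)
        (h K (List.mem_filter.2 ⟨hC K hK, ?_⟩))
      · exact List.mem_filter.2 ⟨hC L hL, hF K hK L hL⟩
      · rw [List.all_eq_true]
        intro t ht
        simp [hKT t ht]

end Generators

/-! ### Fans over the seven rays: necessary conditions, and support functions of the complete ones.
-/

section Masks

open PointedCone

/-- The cone spanned by the generators whose index does not belong to the mask `K`. -/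
def maskCone (K : ℕ) : PointedCone ℝ (Fin 4 → ℝ) := hull ℝ (genVec '' {i | K.testBit i = false})

/-- `K` is the mask of the generators that do not span an extreme ray of `σ`. -/
def IsMask (σ : PointedCone ℝ (Fin 4 → ℝ)) (K : ℕ) : Prop :=
  ∀ i : Fin 7, K.testBit i = false ↔ (genRay i).IsFaceOf σ

theorem exists_isMask (σ : PointedCone ℝ (Fin 4 → ℝ)) : ∃ K < 128, IsMask σ K := by
  classical
  refine ⟨Nat.ofBits fun i : Fin 7 => decide (¬ (genRay i).IsFaceOf σ),
    Nat.ofBits_lt_two_pow _, fun i => ?_⟩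
  rw [Nat.testBit_ofBits_lt _ _ i.2]
  simp

theorem latticeVec_dotProduct_genVec (h : Fin 4 → ℤ) (i : Fin 7) :
    latticeVec h ⬝ᵥ genVec i = pairing h i := by
  simp [dotProduct, Fin.sum_univ_four, latticeVec, genVec, pairing]

/-- It gives at once that the generators are nonzero and that they span seven different rays. -/
theorem exists_wall_separating : ∀ i j : Fin 7, j ≠ i → ∃ h ∈ walls,
    0 < pairing h j ∧ pairing h i ≤ 0 := by
  decide +kernel

theorem genVec_ne_zero (i : Fin 7) : genVec i ≠ 0 := by
  obtain ⟨j, hj⟩ := exists_ne i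
  obtain ⟨h, -, h1, -⟩ := exists_wall_separating j i hj.symm
  intro h0
  have := latticeVec_dotProduct_genVec h i
  rw [h0, dotProduct_zero] at this
  exact h1.ne (by exact_mod_cast this)

theorem genVec_mem_genRay (i : Fin 7) : genVec i ∈ genRay i := subset_hull rfl

theorem eq_of_genVec_mem_genRay {i j : Fin 7} (h : genVec j ∈ genRay i) : j = i := by
  by_contra hne
  obtain ⟨w, -, h1, h2⟩ := exists_wall_separating i j hne
  obtain ⟨t, ht, h⟩ := (mem_hull_singleton_iff _ _).1 h
  have := latticeVec_dotProduct_genVec w j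
  rw [← h, dotProduct_smul, latticeVec_dotProduct_genVec, smul_eq_mul] at this
  have h1' : (0 : ℝ) < pairing w j := by exact_mod_cast h1
  have h2' : (pairing w i : ℝ) ≤ 0 := by exact_mod_cast h2
  have := mul_nonpos_of_nonneg_of_nonpos ht h2'
  linarith

theorem eq_of_smul_genVec_mem_genRay {i j : Fin 7} {t : ℝ} (ht : 0 < t)
    (h : t • genVec j ∈ genRay i) : j = i :=
  eq_of_genVec_mem_genRay ((PointedCone.smul_mem_iff _ ht).1 h)

theorem genRay_isFaceOf_genRay {i j : Fin 7} : (genRay j).IsFaceOf (genRay i) ↔ j = i :=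
  ⟨fun h => eq_of_genVec_mem_genRay (h.le (genVec_mem_genRay j)), fun h => h ▸ .refl _⟩

theorem isMask_genRay (i : Fin 7) : IsMask (genRay i) (rayMask i) := by
  intro j
  rw [genRay_isFaceOf_genRay]
  revert i j
  decide +kernel

theorem isMask_bot : IsMask ⊥ 127 := by
  intro i
  have h1 : Nat.testBit 127 i = true := by
    revert i
    decide +kernel
  rw [h1]
  refine ⟨fun h => absurd h (by simp), fun h => ?_⟩
  exact absurd ((Submodule.mem_bot _).1 (h.le (genVec_mem_genRay i))) (genVec_ne_zero i)

theorem sum_smul_genVec_eq_zero {y : Fin 7 → ℤ} (hy : y ∈ dependencies) :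
    ∑ i, (y i : ℝ) • genVec i = 0 := by
  ext j
  have := sum_dependencies y hy j
  simp only [Finset.sum_apply, Pi.smul_apply, smul_eq_mul, genVec, latticeVec, Pi.zero_apply]
  exact_mod_cast this

variable {Δ : Set (PointedCone ℝ (Fin 4 → ℝ))}

/-- If a linear dependence is nonnegative off the rays of one cone of a fan and nonpositive off the
rays of another, its negative part is supported on common rays. -/
theorem IsFan.isFaceOf_of_dependence (hΔ : IsFan Δ) {σ τ : PointedCone ℝ (Fin 4 → ℝ)}
    (hσ : σ ∈ Δ) (hτ : τ ∈ Δ) {y : Fin 7 → ℝ} (hy : ∑ i, y i • genVec i = 0)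
    (h1 : ∀ i, ¬ (genRay i).IsFaceOf σ → 0 ≤ y i) (h2 : ∀ i, ¬ (genRay i).IsFaceOf τ → y i ≤ 0)
    {i : Fin 7} (hi : y i < 0) : (genRay i).IsFaceOf σ ∧ (genRay i).IsFaceOf τ := by
  have hsum : ∑ i, max (-y i) 0 • genVec i = ∑ i, max (y i) 0 • genVec i := by
    rw [← sub_eq_zero, ← Finset.sum_sub_distrib, ← neg_eq_zero, ← Finset.sum_neg_distrib, ← hy]
    refine Finset.sum_congr rfl fun i _ => ?_
    rw [← sub_smul, ← neg_smul]
    congr 1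
    rcases le_total 0 (y i) with h | h
    · rw [max_eq_right (by linarith), max_eq_left h]; ring
    · rw [max_eq_left (by linarith), max_eq_right h]; ring
  have hσi : ∀ i, max (-y i) 0 • genVec i ∈ σ := by
    intro i
    by_cases hf : (genRay i).IsFaceOf σ
    · exact PointedCone.smul_mem _ (le_max_right _ _) (hf.le (genVec_mem_genRay i))
    · rw [max_eq_right (by linarith [h1 i hf]), zero_smul]; exact zero_mem _
  have hτi : ∀ i, max (y i) 0 • genVec i ∈ τ := by
    intro i
    by_cases hf : (genRay i).IsFaceOf τ
    · exact PointedCone.smul_mem _ (le_max_right _ _) (hf.le (genVec_mem_genRay i))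
    · rw [max_eq_right (h2 i hf), zero_smul]; exact zero_mem _
  have hfi : (genRay i).IsFaceOf σ := by
    by_contra hf
    linarith [h1 i hf]
  -- The negative part of the dependence is a sum of vectors of σ, and it equals the positive part,
  -- which lies in τ. The sum is in the face σ ⊓ τ of σ, hence so is each term.
  have hmem : max (-y i) 0 • genVec i ∈ σ ⊓ τ := by
    refine (hΔ.inter_left σ hσ τ hτ).mem_of_sum_mem hσi ⟨?_, ?_⟩ i
    · exact Submodule.sum_mem _ fun i _ => hσi i
    · rw [hsum]
      exact Submodule.sum_mem _ fun i _ => hτi i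
  rw [max_eq_left (by linarith), PointedCone.smul_mem_iff _ (by linarith : 0 < -y i)] at hmem
  refine ⟨hfi, (hfi.of_le ?_ inf_le_left).trans (hΔ.inter_right σ hσ τ hτ)⟩
  exact Submodule.span_le.2 (by simpa using hmem)

/-- If the negative part of a dependence is supported on rays of σ and the positive part on rays of
τ, their common value lies in σ ⊓ τ. Since this is a common face, all rays in the support belong to
both cones. -/
theorem IsFan.compatible (hΔ : IsFan Δ) {σ τ : PointedCone ℝ (Fin 4 → ℝ)} (hσ : σ ∈ Δ)
    (hτ : τ ∈ Δ) {K L : ℕ} (hK : IsMask σ K) (hL : IsMask τ L) : compatible K L = true := by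
  rw [_root_.compatible, List.all_eq_true]
  intro c hc
  rw [circuitMasks_eq, List.mem_map] at hc
  obtain ⟨y, hy, rfl⟩ := hc
  rw [Bool.not_eq_true', ← Bool.not_eq_true]
  intro h
  simp only [Bool.and_eq_true, disjMask_iff] at h
  obtain ⟨⟨h1, h2⟩, h3⟩ := h
  have hd := sum_smul_genVec_eq_zero hy
  have hd' : ∑ i, (-(y i : ℝ)) • genVec i = 0 := by
    simp only [neg_smul, Finset.sum_neg_distrib, hd, neg_zero]
  have h1' : ∀ i : Fin 7, ¬ (genRay i).IsFaceOf σ → 0 ≤ y i := by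
    intro i hi
    by_contra hlt
    have hb := (testBit_signMasks_snd y i).2 (not_le.1 hlt)
    have hKi : K.testBit i = true := by
      rw [← Bool.not_eq_false, hK i]; exact hi
    rw [h1 i hKi] at hb
    exact Bool.false_ne_true hb
  have h2' : ∀ i : Fin 7, ¬ (genRay i).IsFaceOf τ → y i ≤ 0 := by
    intro i hi
    by_contra hlt
    have hb := (testBit_signMasks_fst y i).2 (not_le.1 hlt)
    have hLi : L.testBit i = true := by
      rw [← Bool.not_eq_false, hL i]; exact hi
    rw [h2 i hLi] at hb
    exact Bool.false_ne_true hb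
  -- The dependence handles its negative indices; its negative, with σ and τ exchanged, handles the
  -- positive ones.
  have key : ∀ i : Fin 7, y i ≠ 0 → (genRay i).IsFaceOf σ ∧ (genRay i).IsFaceOf τ := by
    intro i hi
    rcases hi.lt_or_gt with hi | hi
    · exact hΔ.isFaceOf_of_dependence hσ hτ hd (fun i h => by exact_mod_cast h1' i h)
        (fun i h => by exact_mod_cast h2' i h) (by exact_mod_cast hi)
    · exact (hΔ.isFaceOf_of_dependence hτ hσ hd' (fun i h => by have := h2' i h; simpa using this)
        (fun i h => by have := h1' i h; simpa using this) (by simpa using hi)).symm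
  rw [Bool.not_eq_true', ← Bool.not_eq_true, disjMask_iff] at h3
  push Not at h3
  obtain ⟨i, hi, hi'⟩ := h3
  rw [ne_eq, Bool.not_eq_false, Nat.testBit_or, Bool.or_eq_true] at hi'
  have hi7 : i < 7 := hi'.elim (lt_of_testBit_signMasks_fst y) (lt_of_testBit_signMasks_snd y)
  have hne : y ⟨i, hi7⟩ ≠ 0 := by
    rcases hi' with hi' | hi'
    · exact ((testBit_signMasks_fst y ⟨i, hi7⟩).1 hi').ne'
    · exact ((testBit_signMasks_snd y ⟨i, hi7⟩).1 hi').ne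
  obtain ⟨f1, f2⟩ := key _ hne
  rw [← hK] at f1
  rw [← hL] at f2
  rw [Nat.testBit_or, Bool.or_eq_true] at hi
  rcases hi with hi | hi <;> simp_all

theorem IsFan.eq_maskCone (hΔ : IsFan Δ) (hR : fanRays Δ ⊆ Set.range genRay)
    {σ : PointedCone ℝ (Fin 4 → ℝ)} (hσ : σ ∈ Δ) {K : ℕ} (hK : IsMask σ K) : σ = maskCone K := by
  refine le_antisymm ?_ (Submodule.span_le.2 ?_)
  · conv_lhs => rw [hΔ.eq_sSup_rays hσ]
    refine sSup_le ?_
    rintro ρ ⟨hρ, hf⟩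
    obtain ⟨i, rfl⟩ := hR hρ
    exact Submodule.span_mono (Set.singleton_subset_iff.2 ⟨i, (hK i).2 hf, rfl⟩)
  · rintro _ ⟨i, hi, rfl⟩
    exact ((hK i).1 hi).le (genVec_mem_genRay i)

/-- Compatibility with the zero cone excludes positive dependences among the rays, and compatibility
with a ray of σ itself excludes writing that generator through other rays of σ. -/
theorem IsFan.mem_candidates (hΔ : IsFan Δ) {σ : PointedCone ℝ (Fin 4 → ℝ)} (hσ : σ ∈ Δ) {K : ℕ}
    (hlt : K < 128) (hK : IsMask σ K) : K ∈ candidates := by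
  rw [candidates, List.mem_filter, List.mem_range]
  refine ⟨hlt, ?_⟩
  rw [Bool.and_eq_true, List.all_eq_true]
  refine ⟨hΔ.compatible hσ hΔ.bot_mem hK isMask_bot, fun i hi => ?_⟩
  rw [List.mem_range] at hi
  rw [Bool.or_eq_true]
  by_cases hb : K.testBit i = true
  · exact Or.inl hb
  · right
    rw [Bool.not_eq_true] at hb
    have hf := (hK ⟨i, hi⟩).1 hb
    exact hΔ.compatible hσ (hΔ.face_mem σ hσ _ hf) hK (isMask_genRay ⟨i, hi⟩)

theorem dotProduct_nonneg_of_mem_maskCone {K : ℕ} {x : Fin 4 → ℝ} (hx : x ∈ maskCone K)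
    {u : Fin 4 → ℝ} (hu : ∀ i : Fin 7, K.testBit i = false → 0 ≤ u ⬝ᵥ genVec i) :
    0 ≤ u ⬝ᵥ x := by
  obtain ⟨c, hc, hc', rfl⟩ := (mem_hull_image_iff _ _ _).1 hx
  rw [dotProduct_sum]
  refine Finset.sum_nonneg fun i _ => ?_
  rw [dotProduct_smul, smul_eq_mul]
  by_cases hi : K.testBit i = false
  · exact mul_nonneg (hc i) (hu i hi)
  · rw [hc' i hi, zero_mul]

/-- A wall that is negative at the test vector must be negative on some generator of any cone
containing that vector. -/
theorem IsCompleteFan.exists_mask (hc : IsCompleteFan Δ) (hΔ : IsFan Δ)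
    (hR : fanRays Δ ⊆ Set.range genRay) {T : List ℕ} (hT : T ∈ testMasks) :
    ∃ σ ∈ Δ, ∃ K < 128, IsMask σ K ∧ ∀ t ∈ T, subMask t K = false := by
  rw [testMasks_eq, List.mem_map] at hT
  obtain ⟨t, ht, rfl⟩ := hT
  obtain ⟨σ, hσ, hx⟩ := hc (latticeVec t.1)
  obtain ⟨K, hlt, hK⟩ := exists_isMask σ
  refine ⟨σ, hσ, K, hlt, hK, fun k hk => ?_⟩
  obtain ⟨h, hh, rfl⟩ := List.mem_map.1 hk
  rw [← Bool.not_eq_true, subMask_iff]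
  intro hsub
  rw [hΔ.eq_maskCone hR hσ hK] at hx
  have hnonneg := dotProduct_nonneg_of_mem_maskCone hx (u := latticeVec h) fun i hi => by
    rw [latticeVec_dotProduct_genVec]
    by_contra hlt
    have hneg : pairing h i < 0 := by exact_mod_cast not_le.1 hlt
    rw [hsub i ((testBit_signMasks_snd _ i).2 hneg)] at hi
    exact Bool.false_ne_true hi.symm
  have hneg := tests_neg t ht h hh
  have heq : latticeVec h ⬝ᵥ latticeVec t.1 =
      ((h 0 * t.1 0 + h 1 * t.1 1 + h 2 * t.1 2 + h 3 * t.1 3 : ℤ) : ℝ) := by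
    simp [dotProduct, Fin.sum_univ_four, latticeVec]
  rw [heq] at hnonneg
  have : (0 : ℤ) ≤ h 0 * t.1 0 + h 1 * t.1 1 + h 2 * t.1 2 + h 3 * t.1 3 := by
    exact_mod_cast hnonneg
  omega

theorem IsCompleteFan.exists_certificate (hc : IsCompleteFan Δ) (hΔ : IsFan Δ)
    (hR : fanRays Δ ⊆ Set.range genRay) : ∃ M ∈ certificateMasks, ∀ σ ∈ Δ, ∀ K < 128,
      IsMask σ K → covered M K = true := by
  obtain ⟨M, hM, h⟩ := exists_certificate_of_search {K | K < 128 ∧ ∃ σ ∈ Δ, IsMask σ K}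
    (fun K ⟨_, σ, hσ, hK⟩ L ⟨_, τ, hτ, hL⟩ => hΔ.compatible hσ hτ hK hL) testMasks
    (fun T hT => by
      obtain ⟨σ, hσ, K, hlt, hK, h⟩ := hc.exists_mask hΔ hR hT
      exact ⟨K, ⟨hlt, σ, hσ, hK⟩, h⟩)
    candidates (fun K ⟨hlt, σ, hσ, hK⟩ => hΔ.mem_candidates hσ hlt hK) search_eq_true
  exact ⟨M, hM, fun σ hσ K hlt hK => h K ⟨hlt, σ, hσ, hK⟩⟩

/-- Some rational functional exceeds the values `-c` on the generators exactly at the mask `K`. -/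
def HasVertex (c : Fin 7 → ℤ) (K : ℕ) : Prop :=
  ∃ q : Fin 4 → ℚ, ∀ i : Fin 7, 0 ≤ (c i : ℝ) + ratVec q ⬝ᵥ genVec i ∧
    (K.testBit i = true ↔ 0 < (c i : ℝ) + ratVec q ⬝ᵥ genVec i)

/-- At the midpoint each slack is the average of two nonnegative slacks, hence positive exactly when
one of them is. -/
theorem HasVertex.or {c : Fin 7 → ℤ} {K L : ℕ} (hK : HasVertex c K) (hL : HasVertex c L) :
    HasVertex c (K ||| L) := by
  obtain ⟨q, hq⟩ := hK
  obtain ⟨r, hr⟩ := hL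
  refine ⟨fun j => (q j + r j) / 2, fun i => ?_⟩
  have heq : (c i : ℝ) + ratVec (fun j => (q j + r j) / 2) ⬝ᵥ genVec i =
      (((c i : ℝ) + ratVec q ⬝ᵥ genVec i) + ((c i : ℝ) + ratVec r ⬝ᵥ genVec i)) / 2 := by
    simp only [dotProduct, Fin.sum_univ_four, ratVec]
    push_cast
    ring
  rw [heq, Nat.testBit_or, Bool.or_eq_true, (hq i).2, (hr i).2]
  have h1 := (hq i).1
  have h2 := (hr i).1
  refine ⟨by linarith, ?_, ?_⟩
  · rintro (h | h) <;> linarith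
  · intro h
    by_contra! h'
    linarith

theorem HasVertex.foldr_or {c : Fin 7 → ℤ} (l : List ℕ) (hl : ∀ k ∈ l, HasVertex c k)
    (hne : l ≠ []) : HasVertex c (l.foldr (· ||| ·) 0) := by
  induction l with
  | nil => exact absurd rfl hne
  | cons k l ih =>
    rw [List.foldr_cons]
    by_cases h : l = []
    · subst h
      simpa using hl k (by simp)
    · exact (hl k (by simp)).or (ih (fun k hk => hl k (by simp [hk])) h)

theorem HasVertex.of_covered {c : Fin 7 → ℤ} {M : List ℕ} (hM : ∀ k ∈ M, HasVertex c k) {K : ℕ}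
    (h : covered M K = true) : HasVertex c K := by
  rw [covered, Bool.and_eq_true, Nat.beq_eq, Bool.not_eq_true', ← Bool.not_eq_true, Nat.beq_eq] at h
  obtain ⟨h0, h⟩ := h
  rw [← h]
  -- The condition K ≠ 0 in `covered` excludes the empty union, to which no point of the polytope is
  -- attached.
  refine HasVertex.foldr_or _ (fun k hk => hM k (List.mem_filter.1 hk).1) fun hnil => h0 ?_
  rw [← h, hnil]
  rfl

/-- The functional of σ has zero slack on the generators of σ, where that of τ has nonnegative
slack; this gives the inequality on σ. Equality kills the coefficient of each generator on which the
functional of τ has positive slack, that is, of each generator absent from τ. -/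
theorem IsFan.hasStrictSupport_of_hasVertex (hΔ : IsFan Δ) (hR : fanRays Δ ⊆ Set.range genRay)
    {c : Fin 7 → ℤ} (h : ∀ σ ∈ Δ, ∀ K < 128, IsMask σ K → HasVertex c K) :
    HasStrictSupport Δ := by
  have hex : ∀ σ : PointedCone ℝ (Fin 4 → ℝ), ∃ q : Fin 4 → ℚ, σ ∈ Δ → ∃ K, IsMask σ K ∧
      ∀ i : Fin 7, 0 ≤ (c i : ℝ) + ratVec q ⬝ᵥ genVec i ∧
        (K.testBit i = true ↔ 0 < (c i : ℝ) + ratVec q ⬝ᵥ genVec i) := by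
    intro σ
    by_cases hσ : σ ∈ Δ
    · obtain ⟨K, hlt, hK⟩ := exists_isMask σ
      obtain ⟨q, hq⟩ := h σ hσ K hlt hK
      exact ⟨q, fun _ => ⟨K, hK, hq⟩⟩
    · exact ⟨0, fun h => absurd h hσ⟩
  choose q hq using hex
  refine ⟨q, fun σ hσ τ hτ x hx => ?_⟩
  obtain ⟨K, hK, hqσ⟩ := hq σ hσ
  obtain ⟨L, hL, hqτ⟩ := hq τ hτ
  rw [hΔ.eq_maskCone hR hσ hK] at hx
  obtain ⟨a, ha, ha', rfl⟩ := (mem_hull_image_iff _ _ _).1 hx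
  have hterm : ∀ i ∈ Finset.univ, a i * (ratVec (q σ) ⬝ᵥ genVec i) ≤
      a i * (ratVec (q τ) ⬝ᵥ genVec i) := by
    intro i _
    by_cases hi : K.testBit i = false
    · refine mul_le_mul_of_nonneg_left ?_ (ha i)
      have h1 : ¬ 0 < (c i : ℝ) + ratVec (q σ) ⬝ᵥ genVec i := by
        rw [← (hqσ i).2, hi]; simp
      linarith [(hqτ i).1]
    · rw [ha' i hi, zero_mul, zero_mul]
  simp only [dotProduct_sum, dotProduct_smul, smul_eq_mul]
  refine ⟨Finset.sum_le_sum hterm, fun hle => ?_⟩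
  have heq := (Finset.sum_eq_sum_iff_of_le hterm).1 (le_antisymm (Finset.sum_le_sum hterm) hle)
  rw [hΔ.eq_maskCone hR hτ hL]
  refine (mem_hull_image_iff _ _ _).2 ⟨a, ha, fun i hi => ?_, rfl⟩
  by_contra hne
  have hi' : L.testBit i = true := by simpa using hi
  have h2 := (hqτ i).2.1 hi'
  have hKi : K.testBit i = false := by
    by_contra hK'
    exact hne (ha' i hK')
  have h1 : ¬ 0 < (c i : ℝ) + ratVec (q σ) ⬝ᵥ genVec i := by
    rw [← (hqσ i).2, hKi]; simp
  have := mul_left_cancel₀ hne (heq i (Finset.mem_univ i))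
  linarith

theorem IsFan.hasStrictSupport (hΔ : IsFan Δ) (hR : fanRays Δ ⊆ Set.range genRay)
    (hc : IsCompleteFan Δ) : HasStrictSupport Δ := by
  obtain ⟨M, hM, h⟩ := hc.exists_certificate hΔ hR
  rw [certificateMasks_eq, List.mem_map] at hM
  obtain ⟨c, hc, rfl⟩ := hM
  refine hΔ.hasStrictSupport_of_hasVertex hR (c := certValue c.1) fun σ hσ K hlt hK =>
    HasVertex.of_covered (fun k hk => ?_) (h σ hσ K hlt hK)
  obtain ⟨v, hv, rfl⟩ := List.mem_map.1 hk
  refine ⟨fun j => v.2 j, fun i => ?_⟩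
  have heq : ratVec (fun j => (v.2 j : ℚ)) = latticeVec v.2 := by
    ext j; simp [ratVec, latticeVec]
  rw [heq, latticeVec_dotProduct_genVec]
  exact_mod_cast certificates_spec c hc v hv i

end Masks

/-! ### Fans given by lists of masks: verifying axioms, maximality, simpliciality and
incompleteness. -/

section ListFans

open PointedCone

/-- The fan of all faces of the cones with the given masks. -/
def listFan (L : List ℕ) : Set (PointedCone ℝ (Fin 4 → ℝ)) :=
  {τ | ∃ K ∈ L, τ.IsFaceOf (maskCone K)}

/-- The cones with the given masks are salient with the expected rays and meet in common faces. -/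
def fanCheck (L : List ℕ) : Bool :=
  !L.isEmpty && L.all fun K => separated K 127 && (L.all fun K' => separated K K') &&
    (List.range 7).all fun i => K.testBit i || separated K (rayMask i)

/-- No further cone is compatible with the cones with the given masks. -/
def maximalCheck (L : List ℕ) : Bool :=
  (List.range 128).all fun K => !(compatible K 127 && L.all (compatible K)) ||
    L.any fun K' => subMask K' K

/-- Every cone with one of the given masks has linearly independent generators. -/
def simplicialCheck (L : List ℕ) : Bool :=
  L.all fun K => (List.range 7).all fun i => K.testBit i ||
    wallMasks.any fun w => (w.1 ||| w.2).testBit i && subMask (w.1 ||| w.2) (K ||| 2 ^ i)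

theorem PointedCone.IsFaceOf.nonempty_inter {E : Type*} [AddCommGroup E] [Module ℝ E] {S : Set E}
    {F : PointedCone ℝ E} (hF : F.IsFaceOf (hull ℝ S)) {v : E} (hv : v ∈ F) (h0 : v ≠ 0) :
    (S ∩ F).Nonempty := by
  by_contra he
  have heq := hF.eq_hull_inter
  rw [Set.not_nonempty_iff_eq_empty.1 he] at heq
  have hbot : F = ⊥ := heq.trans Submodule.span_empty
  rw [hbot] at hv
  exact h0 ((Submodule.mem_bot _).1 hv)

theorem testBit_foldr_or (l : List ℕ) (i : ℕ) :
    (l.foldr (· ||| ·) 0).testBit i = true ↔ ∃ k ∈ l, k.testBit i = true := by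
  induction l with
  | nil => simp
  | cons k l ih => simp [Nat.testBit_or, ih]

theorem testBit_127 (i : Fin 7) : Nat.testBit 127 i = true := by
  revert i
  decide +kernel

theorem testBit_rayMask (i j : Fin 7) : (rayMask i).testBit j = false ↔ j = i := by
  revert i j
  decide +kernel

/-- The real linear functional given by an integral vector. -/
noncomputable def intFunctional (h : Fin 4 → ℤ) : (Fin 4 → ℝ) →ₗ[ℝ] ℝ :=
  dotProductBilin ℝ ℝ (latticeVec h)

theorem intFunctional_genVec (h : Fin 4 → ℤ) (i : Fin 7) :
    intFunctional h (genVec i) = pairing h i :=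
  latticeVec_dotProduct_genVec h i

theorem intFunctional_sum_genVec (l : List (Fin 4 → ℤ)) (i : Fin 7) :
    (l.map intFunctional).sum (genVec i) = (l.map fun h => (pairing h i : ℝ)).sum := by
  induction l with
  | nil => simp
  | cons h l ih => simp [ih, intFunctional_genVec]

/-- All walls that weakly separate the two cones are added up. Their values on each generator of
either cone have a common sign, so the sum is nonzero wherever one of them is; the check guarantees
this on every generator belonging to only one cone. -/
theorem exists_functional_of_separated {K L : ℕ} (h : separated K L = true) :
    ∃ l : (Fin 4 → ℝ) →ₗ[ℝ] ℝ, ∀ i : Fin 7,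
      (K.testBit i = false → 0 ≤ l (genVec i)) ∧ (L.testBit i = false → l (genVec i) ≤ 0) ∧
      (K.testBit i = false → L.testBit i = true → 0 < l (genVec i)) ∧
      (K.testBit i = true → L.testBit i = false → l (genVec i) < 0) := by
  set W := walls.filter fun h => subMask (signMasks (pairing h)).2 K &&
    subMask (signMasks (pairing h)).1 L with hW
  have hmem : ∀ h ∈ W, ∀ i : Fin 7, (K.testBit i = false → 0 ≤ pairing h i) ∧
      (L.testBit i = false → pairing h i ≤ 0) := by
    intro h hh i
    rw [hW, List.mem_filter, Bool.and_eq_true, subMask_iff, subMask_iff] at hh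
    refine ⟨fun hi => ?_, fun hi => ?_⟩
    · by_contra hlt
      rw [hh.2.1 i ((testBit_signMasks_snd _ i).2 (not_le.1 hlt))] at hi
      exact Bool.false_ne_true hi.symm
    · by_contra hlt
      rw [hh.2.2 i ((testBit_signMasks_fst _ i).2 (not_le.1 hlt))] at hi
      exact Bool.false_ne_true hi.symm
  have hmasks : (wallMasks.filter fun w => subMask w.2 K && subMask w.1 L) =
      W.map fun h => signMasks (pairing h) := by
    rw [wallMasks_eq, List.filter_map]
    rfl
  rw [separated, hmasks, Bool.and_eq_true, subMask_iff, subMask_iff] at h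
  have hnonneg : ∀ i : Fin 7, K.testBit i = false →
      ∀ x ∈ W.map (fun h => (pairing h i : ℝ)), 0 ≤ x := by
    intro i hi x hx
    obtain ⟨w, hw, rfl⟩ := List.mem_map.1 hx
    exact_mod_cast (hmem w hw i).1 hi
  have hnonpos : ∀ i : Fin 7, L.testBit i = false →
      ∀ x ∈ W.map (fun h => -(pairing h i : ℝ)), 0 ≤ x := by
    intro i hi x hx
    obtain ⟨w, hw, rfl⟩ := List.mem_map.1 hx
    have : (pairing w i : ℝ) ≤ 0 := by exact_mod_cast (hmem w hw i).2 hi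
    linarith
  have hneg : ∀ i : Fin 7, (W.map fun h => -(pairing h i : ℝ)).sum =
      -(W.map fun h => (pairing h i : ℝ)).sum := by
    intro i
    rw [List.sum_neg, List.map_map]
    rfl
  refine ⟨(W.map intFunctional).sum, fun i => ?_⟩
  rw [intFunctional_sum_genVec]
  refine ⟨fun hi => List.sum_nonneg (hnonneg i hi), fun hi => ?_, fun hK hL => ?_,
    fun hK hL => ?_⟩
  · have := List.sum_nonneg (hnonpos i hi)
    rw [hneg] at this
    linarith
  · have hb := h.1 i hL
    rw [Nat.testBit_or, hK, Bool.false_or, testBit_foldr_or] at hb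
    obtain ⟨k, hk, hb⟩ := hb
    simp only [List.map_map, List.mem_map, Function.comp] at hk
    obtain ⟨w, hw, rfl⟩ := hk
    rw [testBit_signMasks_fst] at hb
    have hb' : (0 : ℝ) < pairing w i := by exact_mod_cast hb
    exact hb'.trans_le (List.single_le_sum (hnonneg i hK) _ (List.mem_map.2 ⟨w, hw, rfl⟩))
  · have hb := h.2 i hK
    rw [Nat.testBit_or, hL, Bool.false_or, testBit_foldr_or] at hb
    obtain ⟨k, hk, hb⟩ := hb
    simp only [List.map_map, List.mem_map, Function.comp] at hk
    obtain ⟨w, hw, rfl⟩ := hk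
    rw [testBit_signMasks_snd] at hb
    have hb' : (pairing w i : ℝ) < 0 := by exact_mod_cast hb
    have := List.single_le_sum (hnonpos i hL) _ (List.mem_map.2 ⟨w, hw, rfl⟩)
    rw [hneg] at this
    linarith

theorem functional_nonneg_of_mem_maskCone {K : ℕ} {x : Fin 4 → ℝ} (hx : x ∈ maskCone K)
    {l : (Fin 4 → ℝ) →ₗ[ℝ] ℝ} (hl : ∀ i : Fin 7, K.testBit i = false → 0 ≤ l (genVec i)) :
    0 ≤ l x := by
  have : maskCone K ≤ (PointedCone.positive ℝ ℝ).comap l := by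
    refine Submodule.span_le.2 ?_
    rintro _ ⟨i, hi, rfl⟩
    exact hl i hi
  exact this hx

/-- A point of a cone at which a nonnegative functional vanishes lies in the subcone spanned by the
generators at which the functional vanishes. -/
theorem mem_maskCone_of_functional_eq_zero {K L : ℕ} {x : Fin 4 → ℝ} (hx : x ∈ maskCone K)
    {l : (Fin 4 → ℝ) →ₗ[ℝ] ℝ} (hl : ∀ i : Fin 7, K.testBit i = false → 0 ≤ l (genVec i))
    (hl' : ∀ i : Fin 7, K.testBit i = false → L.testBit i = true → 0 < l (genVec i))
    (h0 : l x = 0) : x ∈ maskCone L := by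
  obtain ⟨c, hc, hc', rfl⟩ := (mem_hull_image_iff _ _ _).1 hx
  refine (mem_hull_image_iff _ _ _).2 ⟨c, hc, fun i hi => ?_, rfl⟩
  have hi : L.testBit i = true := by simpa using hi
  by_cases hK : K.testBit i = false
  · rw [map_sum] at h0
    have hterm : ∀ i ∈ Finset.univ, 0 ≤ l (c i • genVec i) := by
      intro i _
      rw [map_smul, smul_eq_mul]
      by_cases hK : K.testBit i = false
      · exact mul_nonneg (hc i) (hl i hK)
      · rw [hc' i hK, zero_mul]
    have := (Finset.sum_eq_zero_iff_of_nonneg hterm).1 h0 i (Finset.mem_univ i)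
    rw [map_smul, smul_eq_mul] at this
    exact (mul_eq_zero.1 this).resolve_right (hl' i hK hi).ne'
  · exact hc' i hK

theorem isFaceOf_of_separated {K L : ℕ} (h : separated K L = true) :
    (maskCone K ⊓ maskCone L).IsFaceOf (maskCone K) ∧
      (maskCone K ⊓ maskCone L).IsFaceOf (maskCone L) := by
  obtain ⟨l, hl⟩ := exists_functional_of_separated h
  have h1 : ∀ x ∈ maskCone K, 0 ≤ l x := fun x hx =>
    functional_nonneg_of_mem_maskCone hx fun i hi => (hl i).1 hi
  have h2 : ∀ x ∈ maskCone L, 0 ≤ (-l) x := fun x hx =>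
    functional_nonneg_of_mem_maskCone hx fun i hi => by simpa using (hl i).2.1 hi
  constructor
  · refine isFaceOf_of_functional l inf_le_left h1 fun x hx => ⟨fun hx' => ?_, fun h0 => ⟨hx, ?_⟩⟩
    · have := h2 x hx'.2
      rw [LinearMap.neg_apply] at this
      linarith [h1 x hx]
    · exact mem_maskCone_of_functional_eq_zero hx (fun i hi => (hl i).1 hi)
        (fun i hi hi' => (hl i).2.2.1 hi hi') h0
  · refine isFaceOf_of_functional (-l) inf_le_right h2 fun x hx => ⟨fun hx' => ?_, fun h0 => ⟨?_, hx⟩⟩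
    · have := h2 x hx
      rw [LinearMap.neg_apply] at this ⊢
      linarith [h1 x hx'.1]
    · exact mem_maskCone_of_functional_eq_zero hx (fun i hi => by simpa using (hl i).2.1 hi)
        (fun i hi hi' => by simpa using (hl i).2.2.2 hi' hi) h0

theorem maskCone_rayMask (i : Fin 7) : maskCone (rayMask i) = genRay i := by
  rw [maskCone, genRay]
  congr 1
  have : {j : Fin 7 | (rayMask i).testBit j = false} = {i} := by
    ext j
    exact testBit_rayMask i j
  rw [this, Set.image_singleton]

/-- Mask 127 is the zero cone, so the separating functional is strictly positive on every generator.
-/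
theorem salient_maskCone_of_separated {K : ℕ} (h : separated K 127 = true) :
    (maskCone K : ConvexCone ℝ (Fin 4 → ℝ)).Salient := by
  obtain ⟨l, hl⟩ := exists_functional_of_separated h
  intro x hx hx0 hnx
  rw [PointedCone.mem_toConvexCone] at hx hnx
  have h1 := functional_nonneg_of_mem_maskCone hx fun i hi => (hl i).1 hi
  have h2 := functional_nonneg_of_mem_maskCone hnx fun i hi => (hl i).1 hi
  rw [map_neg] at h2
  have h3 : x ∈ maskCone 127 := mem_maskCone_of_functional_eq_zero hx (fun i hi => (hl i).1 hi)
    (fun i hi hi' => (hl i).2.2.1 hi hi') (by linarith)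
  have h4 : maskCone 127 = ⊥ := by
    have : {i : Fin 7 | Nat.testBit 127 i = false} = ∅ := by
      ext i
      simp [testBit_127 i]
    rw [maskCone, this, Set.image_empty]
    exact Submodule.span_empty
  rw [h4] at h3
  exact hx0 ((Submodule.mem_bot _).1 h3)

theorem isRationalPolyhedral_maskCone (K : ℕ) : IsRationalPolyhedral (maskCone K) := by
  classical
  refine ⟨(Finset.univ.filter fun i : Fin 7 => K.testBit i = false).image gen, ?_⟩
  rw [maskCone]
  congr 1
  ext x
  simp [genVec]

theorem genVec_mem_maskCone {K : ℕ} {i : Fin 7} (h : K.testBit i = false) :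
    genVec i ∈ maskCone K := subset_hull ⟨i, h, rfl⟩

/-- Separating a cone from the ray of one of its own generators shows that the ray is a face.
Conversely, an extreme ray has to contain one of the generators, and different generators span
different rays. -/
theorem isMask_maskCone {K : ℕ}
    (h : ∀ i : Fin 7, K.testBit i = false → separated K (rayMask i) = true) :
    IsMask (maskCone K) K := by
  intro i
  constructor
  · intro hi
    have hf := (isFaceOf_of_separated (h i hi)).1
    rw [maskCone_rayMask] at hf
    convert hf
    refine (inf_eq_right.2 ?_).symm
    exact Submodule.span_le.2 (by simpa using genVec_mem_maskCone hi)
  · intro hf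
    obtain ⟨_, ⟨j, hj, rfl⟩, hji⟩ := hf.nonempty_inter (genVec_mem_genRay i) (genVec_ne_zero i)
    rw [← eq_of_genVec_mem_genRay hji]
    exact hj

theorem fanCheck_spec {L : List ℕ} (h : fanCheck L = true) : L ≠ [] ∧ ∀ K ∈ L,
    separated K 127 = true ∧ (∀ K' ∈ L, separated K K' = true) ∧
      ∀ i : Fin 7, K.testBit i = false → separated K (rayMask i) = true := by
  simp only [fanCheck, Bool.and_eq_true, List.all_eq_true, Bool.or_eq_true, List.mem_range,
    Bool.not_eq_true', List.isEmpty_eq_false_iff] at h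
  refine ⟨h.1, fun K hK => ⟨(h.2 K hK).1.1, (h.2 K hK).1.2, fun i hi => ?_⟩⟩
  refine ((h.2 K hK).2 i i.2).resolve_left ?_
  rw [hi]
  exact Bool.false_ne_true

theorem isFan_listFan {L : List ℕ} (h : fanCheck L = true) : IsFan (listFan L) := by
  obtain ⟨hne, h⟩ := fanCheck_spec h
  have hinter : ∀ σ ∈ listFan L, ∀ τ ∈ listFan L, (σ ⊓ τ).IsFaceOf σ := by
    rintro σ ⟨K, hK, hσ⟩ τ ⟨K', hK', hτ⟩
    have hf := isFaceOf_of_separated ((h K hK).2.1 K' hK')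
    exact hσ.inf_of_common hτ hf.1 hf.2
  constructor
  · refine (Set.Finite.biUnion L.finite_toSet fun K _ =>
      (isRationalPolyhedral_maskCone K).finite_faces).subset ?_
    rintro τ ⟨K, hK, hτ⟩
    exact Set.mem_biUnion hK hτ
  · obtain ⟨K, hK⟩ := List.exists_mem_of_ne_nil L hne
    exact ⟨_, K, hK, .refl _⟩
  · rintro τ ⟨K, hK, hτ⟩
    exact isRationalPolyhedral_of_isFaceOf (isRationalPolyhedral_maskCone K) hτ
  · rintro τ ⟨K, hK, hτ⟩
    exact salient_of_le hτ.le (salient_maskCone_of_separated (h K hK).1)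
  · rintro τ ⟨K, hK, hτ⟩ ρ hρ
    exact ⟨K, hK, hρ.trans hτ⟩
  · exact hinter
  · intro σ hσ τ hτ
    rw [inf_comm]
    exact hinter τ hτ σ hσ

theorem fanRays_listFan_subset {L : List ℕ} (h : fanCheck L = true) :
    fanRays (listFan L) ⊆ Set.range genRay := by
  rintro ρ ⟨⟨K, hK, hρ⟩, hd⟩
  have hsal := salient_of_le hρ.le (salient_maskCone_of_separated ((fanCheck_spec h).2 K hK).1)
  obtain ⟨v, hv, hv0⟩ := exists_mem_ne_zero_of_coneDim_eq_one hd
  obtain ⟨_, ⟨i, -, rfl⟩, hi⟩ := hρ.nonempty_inter hv hv0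
  exact ⟨i, (eq_hull_singleton_of_coneDim_eq_one hsal hd hi (genVec_ne_zero i)).symm⟩

theorem maskCone_anti {K L : ℕ} (h : subMask K L = true) : maskCone L ≤ maskCone K := by
  refine Submodule.span_mono (Set.image_mono fun i hi => ?_)
  by_contra hK
  have hK : K.testBit i = true := by simpa using hK
  have hi : L.testBit i = false := hi
  rw [subMask_iff.1 h i hK] at hi
  exact Bool.false_ne_true hi.symm

/-- In a larger fan every cone is compatible with all listed ones, so by the check it is contained
in a listed cone. Meeting that cone in a common face, it is itself a face of it. -/
theorem isMaximalFan_listFan {L : List ℕ} (h : fanCheck L = true) (hm : maximalCheck L = true) :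
    IsMaximalFan (Set.range genRay) (listFan L) := by
  refine ⟨⟨isFan_listFan h, fanRays_listFan_subset h⟩, ?_⟩
  rintro Γ ⟨hΓ, hR⟩ hle σ hσ
  have hmask : ∀ K ∈ L, maskCone K ∈ Γ ∧ IsMask (maskCone K) K := fun K hK =>
    ⟨hle ⟨K, hK, .refl _⟩, isMask_maskCone ((fanCheck_spec h).2 K hK).2.2⟩
  obtain ⟨K, hlt, hK⟩ := exists_isMask σ
  rw [maximalCheck, List.all_eq_true] at hm
  have := hm K (List.mem_range.2 hlt)
  rw [Bool.or_eq_true, Bool.not_eq_true', ← Bool.not_eq_true, Bool.and_eq_true, List.all_eq_true,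
    List.any_eq_true] at this
  obtain ⟨K', hK', hsub⟩ := this.resolve_left fun hnot => hnot
    ⟨hΓ.compatible hσ hΓ.bot_mem hK isMask_bot,
      fun K' hK' => hΓ.compatible hσ (hmask K' hK').1 hK (hmask K' hK').2⟩
  have hσle : σ ≤ maskCone K' := by
    rw [hΓ.eq_maskCone hR hσ hK]
    exact maskCone_anti hsub
  refine ⟨K', hK', ?_⟩
  have := hΓ.inter_right σ hσ _ (hmask K' hK').1
  rwa [inf_eq_left.2 hσle] at this

/-- The functionals play the role of a dual basis, up to nonzero scalars. -/
theorem linearIndepOn_genVec {K : ℕ}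
    (h : ∀ i : Fin 7, K.testBit i = false → ∃ l : (Fin 4 → ℝ) →ₗ[ℝ] ℝ, l (genVec i) ≠ 0 ∧
      ∀ j : Fin 7, K.testBit j = false → j ≠ i → l (genVec j) = 0) :
    LinearIndepOn ℝ genVec {i : Fin 7 | K.testBit i = false} := by
  rw [linearIndepOn_iff']
  intro t g ht hsum i hi
  obtain ⟨l, hl, hl'⟩ := h i (ht hi)
  have := congrArg l hsum
  rw [map_sum, map_zero, Finset.sum_eq_single i, map_smul, smul_eq_mul] at this
  · exact (mul_eq_zero.1 this).resolve_right hl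
  · intro j hj hne
    rw [map_smul, hl' j (ht hj) hne, smul_zero]
  · exact fun hn => absurd hi hn

theorem isSimplicialFan_listFan {L : List ℕ} (h : simplicialCheck L = true) :
    IsSimplicialFan (listFan L) := by
  rintro τ ⟨K, hK, hτ⟩
  have hli : LinearIndepOn ℝ id (genVec '' {i : Fin 7 | K.testBit i = false}) := by
    refine (linearIndepOn_genVec fun i hi => ?_).id_image
    simp only [simplicialCheck, List.all_eq_true, Bool.or_eq_true, List.mem_range, List.any_eq_true,
      Bool.and_eq_true, subMask_iff] at h
    obtain ⟨w, hw, h1, h2⟩ := (h K hK i i.2).resolve_left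
      fun hb => Bool.false_ne_true (hi.symm.trans hb)
    rw [wallMasks_eq, List.mem_map] at hw
    obtain ⟨f, -, rfl⟩ := hw
    have hbit : ∀ j : Fin 7, ((signMasks (pairing f)).1 ||| (signMasks (pairing f)).2).testBit j =
        true ↔ pairing f j ≠ 0 := by
      intro j
      rw [Nat.testBit_or, Bool.or_eq_true, testBit_signMasks_fst, testBit_signMasks_snd]
      omega
    refine ⟨intFunctional f, ?_, fun j hj hne => ?_⟩
    · rw [intFunctional_genVec]
      exact_mod_cast (hbit i).1 h1
    · rw [intFunctional_genVec]
      by_contra h0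
      have := h2 j ((hbit j).2 (by exact_mod_cast h0))
      rw [Nat.testBit_or, hj, Bool.false_or, Nat.testBit_two_pow] at this
      have hij : (i : ℕ) = j := by simpa using this
      exact hne (Fin.ext hij.symm)
  rw [hτ.eq_hull_inter]
  exact ⟨_, (Set.toFinite _).subset Set.inter_subset_left, hli.mono Set.inter_subset_left, rfl⟩

/-- A simplicial cone in `ℝ⁴` has at most four extreme rays. -/
theorem card_le_four_of_isSimplicial {σ : PointedCone ℝ (Fin 4 → ℝ)} {K : ℕ} (hK : IsMask σ K)
    (hσ : σ.IsSimplicial) : (Finset.univ.filter fun i : Fin 7 => K.testBit i = false).card ≤ 4 := by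
  classical
  obtain ⟨B, hfin, hli, rfl⟩ := hσ
  have hB : hfin.toFinset.card ≤ 4 := by
    have h1 : LinearIndependent ℝ (fun x : hfin.toFinset => (x : Fin 4 → ℝ)) := by
      have : LinearIndepOn ℝ id (hfin.toFinset : Set (Fin 4 → ℝ)) := by simpa using hli
      exact this
    simpa using h1.fintype_card_le_finrank
  -- The basis B generates the cone, so it meets each extreme ray; different rays are met in
  -- different vectors.
  have hex : ∀ i : Fin 7, ∃ b, K.testBit i = false → b ∈ B ∧ ∃ t : ℝ, 0 < t ∧ t • genVec i = b := by
    intro i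
    by_cases hi : K.testBit i = false
    · have hf := (hK i).1 hi
      obtain ⟨b, hbB, hb⟩ := hf.nonempty_inter (genVec_mem_genRay i) (genVec_ne_zero i)
      obtain ⟨t, ht, rfl⟩ := (mem_hull_singleton_iff _ _).1 hb
      refine ⟨_, fun _ => ⟨hbB, t, ht.lt_of_ne fun h0 => ?_, rfl⟩⟩
      rw [← h0, zero_smul] at hbB
      exact hli.ne_zero hbB rfl
    · exact ⟨0, fun h => absurd h hi⟩
  choose b hb using hex
  refine le_trans (Finset.card_le_card_of_injOn b (fun i hi => ?_) fun i hi j hj hij => ?_) hB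
  · simpa using (hb i (by simpa using hi)).1
  · obtain ⟨-, s, hs, hsi⟩ := hb i (by simpa using hi)
    obtain ⟨-, t, ht, htj⟩ := hb j (by simpa using hj)
    refine eq_of_smul_genVec_mem_genRay hs ?_
    rw [hsi, hij, ← htj]
    exact PointedCone.smul_mem _ ht.le (genVec_mem_genRay j)

theorem not_isSimplicialFan_listFan {L : List ℕ} (h : fanCheck L = true) {K : ℕ} (hK : K ∈ L)
    (hcard : 4 < (Finset.univ.filter fun i : Fin 7 => K.testBit i = false).card) :
    ¬ IsSimplicialFan (listFan L) := fun hs =>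
  hcard.not_ge (card_le_four_of_isSimplicial (isMask_maskCone ((fanCheck_spec h).2 K hK).2.2)
    (hs _ ⟨K, hK, .refl _⟩))

/-- Completeness would force all masks of the fan to be covered by a single certificate, and each
certificate misses a listed cone. -/
theorem not_isCompleteFan_listFan {L : List ℕ} (h : fanCheck L = true)
    (hL : ∀ K ∈ L, K < 128)
    (hc : ∀ M ∈ certificateMasks, ∃ K ∈ L, covered M K = false) :
    ¬ IsCompleteFan (listFan L) := fun hcomp => by
  obtain ⟨M, hM, h'⟩ :=
    hcomp.exists_certificate (isFan_listFan h) (fanRays_listFan_subset h)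
  obtain ⟨K, hK, hK'⟩ := hc M hM
  rw [h' _ ⟨K, hK, .refl _⟩ K (hL K hK) (isMask_maskCone ((fanCheck_spec h).2 K hK).2.2)] at hK'
  exact Bool.false_ne_true hK'.symm

theorem mem_maskCone_of_coeff {K : ℕ} {x : Fin 4 → ℝ} (c : Fin 7 → ℝ) (hc : ∀ i, 0 ≤ c i)
    (hK : ∀ i : Fin 7, K.testBit i = true → c i = 0) (hx : ∀ j, ∑ i, c i * (gen i j : ℝ) = x j) :
    x ∈ maskCone K := by
  refine (mem_hull_image_iff _ _ _).2 ⟨c, hc, fun i hi => hK i (by simpa using hi), ?_⟩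
  ext j
  rw [← hx j]
  simp [genVec, latticeVec]

/-- Membership in a cone in which the second generator does not occur. -/
theorem mem_maskCone_of_two {K : ℕ} {x : Fin 4 → ℝ} (s t : ℝ) (hs : 0 ≤ s) (ht : 0 ≤ t)
    (h0 : 0 ≤ x 0 + 2 * s + t) (h1 : 0 ≤ x 1 + 3 * s + 2 * t) (h2 : 0 ≤ x 2 + s + t)
    (h3 : 0 ≤ x 3 + s + t)
    (hK : ∀ i : Fin 7, K.testBit i = true →
      ![s, 0, x 0 + 2 * s + t, x 1 + 3 * s + 2 * t, x 2 + s + t, x 3 + s + t, t] i = 0) :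
    x ∈ maskCone K := by
  refine mem_maskCone_of_coeff _ (fun i => ?_) hK fun j => ?_
  · fin_cases i
    exacts [hs, le_rfl, h0, h1, h2, h3, ht]
  · fin_cases j <;> simp [Fin.sum_univ_succ, gen] <;> ring

end ListFans

/-! ### The four fans in dimension four, and the conclusion. -/

section BaseCase

open PointedCone

theorem isCompleteFan_listFan {L : List ℕ} (h : ∀ x, ∃ K ∈ L, x ∈ maskCone K) :
    IsCompleteFan (listFan L) := fun x => by
  obtain ⟨K, hK, hx⟩ := h x
  exact ⟨_, ⟨K, hK, .refl _⟩, hx⟩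

/-- The least multiple of the first generator that makes all coordinates nonnegative. -/
theorem exists_mem_simplicial_list (x : Fin 4 → ℝ) : ∃ K ∈ [67, 70, 74, 82, 98], x ∈ maskCone K := by
  obtain ⟨s, hs, h0, h1, h2, h3, hcases⟩ : ∃ s : ℝ, 0 ≤ s ∧ 0 ≤ x 0 + 2 * s ∧ 0 ≤ x 1 + 3 * s ∧
      0 ≤ x 2 + s ∧ 0 ≤ x 3 + s ∧
      (s = 0 ∨ x 0 + 2 * s = 0 ∨ x 1 + 3 * s = 0 ∨ x 2 + s = 0 ∨ x 3 + s = 0) := by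
    set s := max 0 (max (max (-x 0 / 2) (-x 1 / 3)) (max (-x 2) (-x 3))) with hs
    have a0 : 0 ≤ s := le_max_left _ _
    have a1 : -x 0 / 2 ≤ s := by simp [hs]
    have a2 : -x 1 / 3 ≤ s := by simp [hs]
    have a3 : -x 2 ≤ s := by simp [hs]
    have a4 : -x 3 ≤ s := by simp [hs]
    refine ⟨s, a0, by linarith, by linarith, by linarith, by linarith, ?_⟩
    rcases max_choice 0 (max (max (-x 0 / 2) (-x 1 / 3)) (max (-x 2) (-x 3))) with h | h
    · exact Or.inl h
    rcases max_choice (max (-x 0 / 2) (-x 1 / 3)) (max (-x 2) (-x 3)) with h' | h'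
    · rcases max_choice (-x 0 / 2) (-x 1 / 3) with h'' | h''
      · exact Or.inr (Or.inl (by linarith))
      · exact Or.inr (Or.inr (Or.inl (by linarith)))
    · rcases max_choice (-x 2) (-x 3) with h'' | h''
      · exact Or.inr (Or.inr (Or.inr (Or.inl (by linarith))))
      · exact Or.inr (Or.inr (Or.inr (Or.inr (by linarith))))
  have key : ∀ K : ℕ, (∀ i : Fin 7, K.testBit i = true →
      ![s, 0, x 0 + 2 * s + 0, x 1 + 3 * s + 2 * 0, x 2 + s + 0, x 3 + s + 0, 0] i = 0) →
      x ∈ maskCone K := fun K hK =>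
    mem_maskCone_of_two s 0 hs le_rfl (by linarith) (by linarith) (by linarith) (by linarith) hK
  rcases hcases with h | h | h | h | h
  · exact ⟨67, by simp, key _ fun i => by fin_cases i <;> simp [Nat.testBit, h]⟩
  · exact ⟨70, by simp, key _ fun i => by fin_cases i <;> simp [Nat.testBit, h]⟩
  · exact ⟨74, by simp, key _ fun i => by fin_cases i <;> simp [Nat.testBit, h]⟩
  · exact ⟨82, by simp, key _ fun i => by fin_cases i <;> simp [Nat.testBit, h]⟩
  · exact ⟨98, by simp, key _ fun i => by fin_cases i <;> simp [Nat.testBit, h]⟩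

/-- The vector is written with multiples s and t of generators 0 and 6 and the remaining part in the
coordinate vectors. Coordinates 0, 2 and 3 determine s and t as a planar problem; coordinate 1 only
decides whether a correction into the non-simplicial cone 10 is needed. -/
theorem exists_mem_nonsimplicial_list (x : Fin 4 → ℝ) :
    ∃ K ∈ [10, 19, 22, 35, 38, 67, 70], x ∈ maskCone K := by
  have key : ∀ K : ℕ, ∀ s t : ℝ, 0 ≤ s → 0 ≤ t → 0 ≤ x 0 + 2 * s + t → 0 ≤ x 1 + 3 * s + 2 * t →
      0 ≤ x 2 + s + t → 0 ≤ x 3 + s + t → (∀ i : Fin 7, K.testBit i = true →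
      ![s, 0, x 0 + 2 * s + t, x 1 + 3 * s + 2 * t, x 2 + s + t, x 3 + s + t, t] i = 0) →
      x ∈ maskCone K := fun K s t h1 h2 h3 h4 h5 h6 => mem_maskCone_of_two s t h1 h2 h3 h4 h5 h6
  -- Without the second coordinate, at least one of the remaining masks applies.
  obtain ⟨s, t, hs, ht, h0, h2, h3, hcases⟩ : ∃ s t : ℝ, 0 ≤ s ∧ 0 ≤ t ∧ 0 ≤ x 0 + 2 * s + t ∧
      0 ≤ x 2 + s + t ∧ 0 ≤ x 3 + s + t ∧
      ((x 2 + s + t = 0 ∧ (s = 0 ∨ x 0 + 2 * s + t = 0)) ∨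
        (x 3 + s + t = 0 ∧ (s = 0 ∨ x 0 + 2 * s + t = 0)) ∨
        (t = 0 ∧ (s = 0 ∨ x 0 + 2 * s + t = 0))) := by
    -- The requirements are s, t ≥ 0, 2s + t ≥ -x 0 and s + t ≥ v, with v the maximum of -x 2 and -x
    -- 3. The cases below pick a vertex of this planar region.
    obtain ⟨v, hv2, hv3, hv⟩ : ∃ v, -x 2 ≤ v ∧ -x 3 ≤ v ∧ (x 2 + v = 0 ∨ x 3 + v = 0) := by
      rcases le_total (-x 2) (-x 3) with h | h
      · exact ⟨-x 3, h, le_rfl, Or.inr (by ring)⟩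
      · exact ⟨-x 2, le_rfl, h, Or.inl (by ring)⟩
    rcases le_total v (-x 0) with huv | huv
    · rcases le_total (-x 0) (2 * v) with h | h
      · refine ⟨-x 0 - v, 2 * v + x 0, by linarith, by linarith, by linarith, by linarith,
          by linarith, ?_⟩
        rcases hv with hv | hv
        · exact Or.inl ⟨by linarith, Or.inr (by ring)⟩
        · exact Or.inr (Or.inl ⟨by linarith, Or.inr (by ring)⟩)
      · rcases le_total 0 (-x 0) with hu | hu
        · exact ⟨-x 0 / 2, 0, by linarith, le_rfl, by linarith, by linarith, by linarith,
            Or.inr (Or.inr ⟨rfl, Or.inr (by ring)⟩)⟩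
        · exact ⟨0, 0, le_rfl, le_rfl, by linarith, by linarith, by linarith,
            Or.inr (Or.inr ⟨rfl, Or.inl rfl⟩)⟩
    · rcases le_total 0 v with h | h
      · refine ⟨0, v, le_rfl, h, by linarith, by linarith, by linarith, ?_⟩
        rcases hv with hv | hv
        · exact Or.inl ⟨by linarith, Or.inl rfl⟩
        · exact Or.inr (Or.inl ⟨by linarith, Or.inl rfl⟩)
      · exact ⟨0, 0, le_rfl, le_rfl, by linarith, by linarith, by linarith,
          Or.inr (Or.inr ⟨rfl, Or.inl rfl⟩)⟩
  rcases lt_or_ge (x 1 + 3 * s + 2 * t) 0 with h1 | h1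
  -- Raising s until the coefficient of coordinate vector 1 vanishes only increases the other
  -- coefficients, and cone 10 omits just generators 1 and 3.
  · refine ⟨10, by simp, key 10 (s - (x 1 + 3 * s + 2 * t) / 3) t (by linarith) ht (by linarith)
      (by linarith) (by linarith) (by linarith) fun i => ?_⟩
    have : x 1 + 3 * (s - (x 1 + 3 * s + 2 * t) / 3) + 2 * t = 0 := by ring
    fin_cases i <;> simp [Nat.testBit, this]
  · rcases hcases with ⟨h, h' | h'⟩ | ⟨h, h' | h'⟩ | ⟨h, h' | h'⟩
    · exact ⟨19, by simp, key _ s t hs ht h0 h1 h2 h3 fun i => by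
        fin_cases i <;> simp [Nat.testBit, h']
        linarith⟩
    · exact ⟨22, by simp, key _ s t hs ht h0 h1 h2 h3 fun i => by
        fin_cases i <;> simp [Nat.testBit, h, h']⟩
    · exact ⟨35, by simp, key _ s t hs ht h0 h1 h2 h3 fun i => by
        fin_cases i <;> simp [Nat.testBit, h']
        linarith⟩
    · exact ⟨38, by simp, key _ s t hs ht h0 h1 h2 h3 fun i => by
        fin_cases i <;> simp [Nat.testBit, h, h']⟩
    · exact ⟨67, by simp, key _ s t hs ht h0 h1 h2 h3 fun i => by
        fin_cases i <;> simp [Nat.testBit, h, h']⟩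
    · exact ⟨70, by simp, key _ s t hs ht h0 h1 h2 h3 fun i => by
        fin_cases i <;> simp [Nat.testBit, h]
        linarith⟩

theorem gen_ne_zero : ∀ i, gen i ≠ 0 := by
  decide +kernel

theorem sSup_range_genRay : sSup (Set.range genRay) = ⊤ := by
  refine eq_top_iff.2 fun x _ => ?_
  obtain ⟨K, -, hx⟩ := exists_mem_simplicial_list x
  refine (show maskCone K ≤ sSup (Set.range genRay) from Submodule.span_le.2 ?_) hx
  rintro _ ⟨i, -, rfl⟩
  have hle : genRay i ≤ sSup (Set.range genRay) := le_sSup (Set.mem_range_self i)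
  exact hle (genVec_mem_genRay i)

theorem isGoodRaySet_range_genRay : IsGoodRaySet (Set.range genRay) where
  finite := Set.finite_range _
  rational := by
    rintro _ ⟨i, rfl⟩
    exact ⟨gen i, gen_ne_zero i, rfl⟩
  sSup_eq_top := sSup_range_genRay
  support := fun _ hΔ hR hc => hΔ.hasStrictSupport hR hc
  -- These are the five cones on four of the vectors v₀, e₁, e₂, e₃, e₄, which satisfy v₀ + 2e₁ +
  -- 3e₂ + e₃ + e₄ = 0; generators 1 and 6 do not occur.
  complete_simplicial := ⟨listFan [67, 70, 74, 82, 98],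
    isMaximalFan_listFan (by decide +kernel) (by decide +kernel),
    isCompleteFan_listFan exists_mem_simplicial_list, isSimplicialFan_listFan (by decide +kernel)⟩
  -- Generator 1 does not occur. Mask 10 is the cone with five extreme rays 0, 2, 4, 5, 6.
  complete_not_simplicial := ⟨listFan [10, 19, 22, 35, 38, 67, 70],
    isMaximalFan_listFan (by decide +kernel) (by decide +kernel),
    isCompleteFan_listFan exists_mem_nonsimplicial_list,
    not_isSimplicialFan_listFan (K := 10) (by decide +kernel) (by decide) (by decide +kernel)⟩
  not_complete_simplicial := ⟨listFan [21, 22, 35, 38, 42, 49, 67, 70, 73, 81],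
    isMaximalFan_listFan (by decide +kernel) (by decide +kernel),
    not_isCompleteFan_listFan (by decide +kernel) (by decide +kernel) (by decide +kernel),
    isSimplicialFan_listFan (by decide +kernel)⟩
  -- This is the preceding fan with the simplicial cones 21 and 22 merged into the cone 20 on
  -- generators 0, 1, 3, 5, 6, along the relation v₀ + v₁ = v₅ + 2v₆.
  not_complete_not_simplicial := ⟨listFan [20, 35, 38, 42, 49, 67, 70, 73, 81],
    isMaximalFan_listFan (by decide +kernel) (by decide +kernel),
    not_isCompleteFan_listFan (by decide +kernel) (by decide +kernel) (by decide +kernel),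
    not_isSimplicialFan_listFan (K := 20) (by decide +kernel) (by decide) (by decide +kernel)⟩

theorem exists_isGoodRaySet {n : ℕ} (hn : 4 ≤ n) :
    ∃ R : Set (PointedCone ℝ (Fin n → ℝ)), IsGoodRaySet R := by
  induction n, hn using Nat.le_induction with
  | base => exact ⟨_, isGoodRaySet_range_genRay⟩
  | succ n _ ih =>
    obtain ⟨R, hR⟩ := ih
    exact ⟨_, hR.suspension⟩

end BaseCase

theorem mainTheorem2 (n : ℕ) (hn : 4 ≤ n) :
    ∃ R : Set (PointedCone ℝ (Fin n → ℝ)),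
      R.Finite ∧ (∀ ρ ∈ R, IsRationalRay ρ) ∧ sSup R = ⊤ ∧
      (∀ Δ, IsMaximalFan R Δ → IsProjectiveFan Δ ∨ ¬ IsCompleteFan Δ) ∧
      (∃ Δ, IsMaximalFan R Δ ∧ IsProjectiveFan Δ ∧ IsSimplicialFan Δ) ∧
      (∃ Δ, IsMaximalFan R Δ ∧ IsProjectiveFan Δ ∧ ¬ IsSimplicialFan Δ) ∧
      (∃ Δ, IsMaximalFan R Δ ∧ ¬ IsProjectiveFan Δ ∧ ¬ IsCompleteFan Δ ∧ IsSimplicialFan Δ) ∧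
      (∃ Δ, IsMaximalFan R Δ ∧ ¬ IsProjectiveFan Δ ∧ ¬ IsCompleteFan Δ ∧ ¬ IsSimplicialFan Δ) := by
  obtain ⟨R, hR⟩ := exists_isGoodRaySet hn
  exact ⟨R, hR.conclusion⟩
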